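/- Let $M$ be a (finite-dimensional, Hausdorff) smooth manifold, $\pi:A\to M$ a smooth real vector bundle of finite rank $n\ge 1$, and $\pi^*:A^*\to M$ its dual bundle. A section $\mu\in\Gamma(A)$ determines the linear function $\tilde\mu:A^*\to\mathbb R$, $\tilde\mu(\xi)=\xi(\mu(\pi^*(\xi)))$; a basic function on $A^*$ is one of the form $f\circ\pi^*$ with $f\in C^\infty(M,\mathbb R)$. A Lie algebroid structure on $A$ is a pair $([\![\,,]\!],\rho)$ of a Lie bracket on $\Gamma(A)$ and a vector bundle homomorphism $\rho:A\to TM$ such that $\rho:\Gamma(A)\to\mathfrak X(M)$ is a Lie algebra homomorphism and $[\![\mu,f\eta]\!]=f[\![\mu,\eta]\!]+(\rho(\mu)f)\,\eta$. A 1-cocycle is a section $\phi\in\Gamma(A^*)$ with $\phi[\![\mu,\eta]\!]=\rho(\mu)(\phi(\eta))-\rho(\eta)(\phi(\mu))$ for all $\mu,\eta\in\Gamma(A)$. A Jacobi structure on a manifold is a pair $(\Lambda,E)$ of a 2-vector and a vector field with $[\Lambda,\Lambda]_{SN}=2E\wedge\Lambda$ and $[E,\Lambda]_{SN}=0$, where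 $[\,,]_{SN}$ is the Schouten-Nijenhuis bracket, with the sign convention for which $[\Lambda,\Lambda]_{SN}(df,dg,dh)=2\sum_{\mathrm{cyc}}\Lambda(d(\Lambda(df,dg)),dh)$; its Jacobi bracket is $\{f,g\}=\Lambda(df,dg)+fE(g)-gE(f)$. It is Poisson if $E=0$. Let $\tilde{\mathcal A}$ be the set of pairs $(([\![\,,]\!],\rho),\phi)$ of a Lie algebroid structure on $A$ and a 1-cocycle $\phi$ of it, and let $\mathcal J$ be the set of Jacobi structures $(\Lambda,E)$ on $A^*$ such that (C1) the Jacobi bracket of two linear functions is linear, and (C2) the Jacobi bracket of a linear function and the constant function $1$ is basic. For $(([\![\,,]\!],\rho),\phi)\in\tilde{\mathcal A}$ put $$\Lambda_{(A^*,\phi)}=\Lambda_{A^*}+\Delta\wedge\phi^v,\qquad E_{(A^*,\phi)}=-\phi^v,$$ where $\Delta$ is the Liouville vector field of $A^*$, $\phi^v$ is the vertical lift of $\phi$, and $\Lambda_{A^*}$ is given by $$\Lambda_{A^*}=\sum_{i<j}\sum_k c_{ij}^k\mu_k\,\frac{\partial}{\partial\mu_i}\wedge\frac{\partial}{\partial\mu_j}+\sum_{i,l}\rho_i^l\,\frac{\partial}{\partial\mu_i}\wedge\frac{\partial}{\partial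 x^l}$$ in local coordinates $(x^l)$ of $M$ and a local frame $(e_i)$ of $A$, with $\mu_i=\tilde e_i$, $[\![e_i,e_j]\!]=\sum_k c_{ij}^k e_k$ and $\rho(e_i)=\sum_l\rho_i^l\,\partial/\partial x^l$. Then $\Psi((([\![\,,]\!],\rho),\phi))=(\Lambda_{(A^*,\phi)},E_{(A^*,\phi)})$ defines a map $\Psi:\tilde{\mathcal A}\to\mathcal J$, and it is a bijection. It restricts to a bijection from the pairs with $\phi=0$ onto the Poisson structures in $\mathcal J$ (those with $E=0$); this is the bijection $([\![\,,]\!],\rho)\mapsto\Lambda_{A^*}$ between the Lie algebroid structures on $A$ and the linear Poisson structures on $A^*$ (the Poisson structures for which the bracket of two linear functions is linear). -/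

import Mathlib

open Bundle Set Topology Module
open scoped Manifold ContDiff Bundle

noncomputable section

set_option maxSynthPendingDepth 5

/-! ### Bivector fields and Jacobi structures on a manifold -/

section Jacobi

variable {E : Type*} [NormedAddCommGroup E] [NormedSpace ℝ E]
  {H : Type*} [TopologicalSpace H] (I : ModelWithCorners ℝ E H)
  (N : Type*) [TopologicalSpace N] [ChartedSpace H N]

/-- The cotangent space of `N` at `p`. -/
abbrev Cotangent {N : Type*} [TopologicalSpace N] [ChartedSpace H N] (p : N) : Type _ :=
  TangentSpace I p →L[ℝ] ℝ

/-- A smooth vector field, as a smooth section of the tangent bundle. -/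
abbrev SmoothVectorField [IsManifold I ∞ N] : Type _ :=
  ContMDiffSection I E ∞ (fun p : N => TangentSpace I p)

/-- A smooth 2-vector (bivector field) on `N`: a smooth section of the bundle of bilinear forms on
the cotangent bundle whose value at each point is alternating. -/
structure BivectorField [IsManifold I ∞ N] where
  /-- the underlying field of bilinear forms on the cotangent spaces -/
  toSection : ContMDiffSection I ((E →L[ℝ] ℝ) →L[ℝ] (E →L[ℝ] ℝ) →L[ℝ] ℝ) ∞
    (fun p : N => Cotangent I p →L[ℝ] Cotangent I p →L[ℝ] ℝ)
  alternating : ∀ (p : N) (α : Cotangent I p), toSection p α α = 0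

variable {I N}

/-- The decomposable bivector `u ∧ v`, that is
`(u ∧ v)(α, β) = α(u) β(v) - α(v) β(u)`. -/
def wedgeVec {p : N} (u v : TangentSpace I p) :
    Cotangent I p →L[ℝ] Cotangent I p →L[ℝ] ℝ :=
  let u' : E := u
  let v' : E := v
  let w : (E →L[ℝ] ℝ) →L[ℝ] (E →L[ℝ] ℝ) →L[ℝ] ℝ :=
    (ContinuousLinearMap.apply ℝ ℝ u').smulRight (ContinuousLinearMap.apply ℝ ℝ v')
      - (ContinuousLinearMap.apply ℝ ℝ v').smulRight (ContinuousLinearMap.apply ℝ ℝ u')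
  w

theorem wedgeVec_apply {p : N} (u v : TangentSpace I p) (α β : Cotangent I p) :
    wedgeVec u v α β = α u * β v - α v * β u := rfl

variable [IsManifold I ∞ N]

/-- The derivative `X(f)` of a function along a vector field. -/
def SmoothVectorField.deriv (X : SmoothVectorField I N) (f : N → ℝ) : N → ℝ :=
  fun p => mvfderiv I f p (X p)

/-- The function `P(df, dg)`. -/
def BivectorField.onDiff (P : BivectorField I N) (f g : N → ℝ) : N → ℝ :=
  fun p => P.toSection p (mvfderiv I f p) (mvfderiv I g p)

/-- The Schouten-Nijenhuis bracket `[P, Q]` of two bivector fields.  It is the 3-vector whose value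
on the differentials `df, dg, dh` is the sum over the cyclic permutations of `(f, g, h)` of
`P(d(Q(df, dg)), dh) + Q(d(P(df, dg)), dh)`.  (Differentials of smooth functions span every
cotangent space, so a 3-vector is determined by these values.) -/
def schoutenBivector (P Q : BivectorField I N) (f g h : N → ℝ) : N → ℝ :=
  P.onDiff (Q.onDiff f g) h + P.onDiff (Q.onDiff g h) f + P.onDiff (Q.onDiff h f) g
    + (Q.onDiff (P.onDiff f g) h + Q.onDiff (P.onDiff g h) f + Q.onDiff (P.onDiff h f) g)

/-- The Schouten-Nijenhuis bracket `[X, P]` of a vector field and a bivector field (the Lie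
derivative of `P` along `X`), evaluated on the differentials `df, dg`. -/
def schoutenVector (X : SmoothVectorField I N) (P : BivectorField I N) (f g : N → ℝ) : N → ℝ :=
  X.deriv (P.onDiff f g) - P.onDiff (X.deriv f) g - P.onDiff f (X.deriv g)

/-- The 3-vector `X ∧ P` evaluated on the differentials `df, dg, dh`. -/
def wedgeVectorBivector (X : SmoothVectorField I N) (P : BivectorField I N) (f g h : N → ℝ) :
    N → ℝ :=
  X.deriv f * P.onDiff g h + X.deriv g * P.onDiff h f + X.deriv h * P.onDiff f g

variable (I N)

/-- A Jacobi structure `(Λ, E)`: a bivector field `Λ` and a vector field `E` with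
`[Λ, Λ] = 2 E ∧ Λ` and `[E, Λ] = 0`. -/
structure JacobiStructure where
  /-- the 2-vector -/
  Lam : BivectorField I N
  /-- the vector field -/
  vec : SmoothVectorField I N
  schouten_self : ∀ f g h : N → ℝ,
    ContMDiff I 𝓘(ℝ, ℝ) ∞ f → ContMDiff I 𝓘(ℝ, ℝ) ∞ g → ContMDiff I 𝓘(ℝ, ℝ) ∞ h →
    schoutenBivector Lam Lam f g h = 2 * wedgeVectorBivector vec Lam f g h
  schouten_vec : ∀ f g : N → ℝ,
    ContMDiff I 𝓘(ℝ, ℝ) ∞ f → ContMDiff I 𝓘(ℝ, ℝ) ∞ g →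
    schoutenVector vec Lam f g = 0

/-- A Poisson structure: a bivector field `Λ` with `[Λ, Λ] = 0`. -/
structure PoissonStructure where
  /-- the 2-vector -/
  Lam : BivectorField I N
  schouten_self : ∀ f g h : N → ℝ,
    ContMDiff I 𝓘(ℝ, ℝ) ∞ f → ContMDiff I 𝓘(ℝ, ℝ) ∞ g → ContMDiff I 𝓘(ℝ, ℝ) ∞ h →
    schoutenBivector Lam Lam f g h = 0

variable {I N}

/-- The Jacobi bracket `{f, g} = Λ(df, dg) + f E(g) - g E(f)`. -/
def JacobiStructure.bracket (J : JacobiStructure I N) (f g : N → ℝ) : N → ℝ :=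
  J.Lam.onDiff f g + f * J.vec.deriv g - g * J.vec.deriv f

/-- The Poisson bracket `{f, g} = Λ(df, dg)`. -/
def PoissonStructure.bracket (P : PoissonStructure I N) (f g : N → ℝ) : N → ℝ :=
  P.Lam.onDiff f g

end Jacobi

/-! ### Lie algebroids -/

section Algebroid

variable {E : Type*} [NormedAddCommGroup E] [NormedSpace ℝ E]
  {H : Type*} [TopologicalSpace H] (I : ModelWithCorners ℝ E H)
  {M : Type*} [TopologicalSpace M] [ChartedSpace H M]
  (F : Type*) [NormedAddCommGroup F] [NormedSpace ℝ F]
  (A : M → Type*) [TopologicalSpace (TotalSpace F A)]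
  [∀ x, AddCommGroup (A x)] [∀ x, Module ℝ (A x)] [∀ x, TopologicalSpace (A x)]
  [FiberBundle F A]

/-- The total space of the dual bundle `A* → M`. -/
abbrev DualTotal : Type _ :=
  TotalSpace (F →L[ℝ] ℝ) (fun x => A x →L[ℝ] ℝ)

variable [VectorBundle ℝ F A]

/-- `Γ(A)`, the space of smooth global sections of `A`. -/
abbrev Sec : Type _ := ContMDiffSection I F ∞ A

variable {I F A} in
/-- The product of a smooth function and a smooth section. -/
def Sec.funSMul (f : C^∞⟮I, M; 𝓘(ℝ, ℝ), ℝ⟯) (η : Sec I F A) : Sec I F A where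
  toFun x := f x • η x
  contMDiff_toFun := f.contMDiff.smul_section η.contMDiff

/-- A Lie algebroid structure on the vector bundle `A → M`: a Lie bracket on `Γ(A)` together with a
homomorphism of vector bundles `ρ : A → TM` such that `ρ : Γ(A) → 𝔛(M)` is a homomorphism of Lie
algebras and the Leibniz rule holds. -/
structure LieAlgebroid [IsManifold I ∞ M] where
  /-- the bracket on sections -/
  bracket : Sec I F A →ₗ[ℝ] Sec I F A →ₗ[ℝ] Sec I F A
  bracket_self : ∀ μ, bracket μ μ = 0
  jacobi : ∀ μ η ζ,
    bracket μ (bracket η ζ) + bracket η (bracket ζ μ) + bracket ζ (bracket μ η) = 0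
  /-- the anchor map -/
  anchor : ∀ x : M, A x →L[ℝ] TangentSpace I x
  anchor_smooth : ContMDiff (I.prod 𝓘(ℝ, F)) I.tangent ∞
    (fun v : TotalSpace F A => (⟨v.proj, anchor v.proj v.2⟩ : TangentBundle I M))
  anchor_bracket : ∀ (μ η : Sec I F A) (x : M),
    anchor x (bracket μ η x)
      = VectorField.mlieBracket I (fun y => anchor y (μ y)) (fun y => anchor y (η y)) x
  leibniz : ∀ (f : C^∞⟮I, M; 𝓘(ℝ, ℝ), ℝ⟯) (μ η : Sec I F A) (x : M),
    bracket μ (Sec.funSMul f η) x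
      = f x • bracket μ η x + mvfderiv I f x (anchor x (μ x)) • η x

/-- `Γ(A*)`, the space of smooth global sections of the dual bundle. -/
abbrev DualSec [∀ x, IsTopologicalAddGroup (A x)] [∀ x, ContinuousSMul ℝ (A x)] : Type _ :=
  ContMDiffSection I (F →L[ℝ] ℝ) ∞ (fun x => A x →L[ℝ] ℝ)

variable {I F A} in
/-- The 1-cocycle condition
`φ⟦μ, η⟧ = ρ(μ)(φ(η)) - ρ(η)(φ(μ))` for all `μ, η ∈ Γ(A)`. -/
def LieAlgebroid.IsCocycle [IsManifold I ∞ M]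
    [∀ x, IsTopologicalAddGroup (A x)] [∀ x, ContinuousSMul ℝ (A x)]
    (L : LieAlgebroid I F A) (φ : DualSec I F A) : Prop :=
  ∀ (μ η : Sec I F A) (x : M),
    φ x (L.bracket μ η x)
      = mvfderiv I (fun y => φ y (η y)) x (L.anchor x (μ x))
        - mvfderiv I (fun y => φ y (μ y)) x (L.anchor x (η x))

/-- A Lie algebroid structure on `A` together with a 1-cocycle. -/
structure AlgebroidWithCocycle [IsManifold I ∞ M]
    [∀ x, IsTopologicalAddGroup (A x)] [∀ x, ContinuousSMul ℝ (A x)] where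
  /-- the Lie algebroid structure -/
  alg : LieAlgebroid I F A
  /-- the 1-cocycle -/
  form : DualSec I F A
  cocycle : alg.IsCocycle form

/-! ### Functions and vector fields on the dual bundle -/

variable {I F A}

/-- The linear function `μ̃` on `A*` determined by a section `μ` of `A`. -/
def linFun (μ : Sec I F A) : DualTotal F A → ℝ := fun p => p.2 (μ p.proj)

variable (I F A) in
/-- A function on `A*` is linear if it is of the form `μ̃` with `μ ∈ Γ(A)`. -/
def IsLinearFun (h : DualTotal F A → ℝ) : Prop := ∃ μ : Sec I F A, h = linFun μ

variable (I F A) in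
/-- A function on `A*` is basic if it is the pull-back of a smooth function on `M`. -/
def IsBasicFun (h : DualTotal F A → ℝ) : Prop :=
  ∃ f : C^∞⟮I, M; 𝓘(ℝ, ℝ), ℝ⟯, h = fun p => f p.proj

variable (I F A) in
/-- Every element of the local frame at `x` (given by the trivialization of `A` at `x` and a basis
of the model fibre) agrees near `x` with a global smooth section. -/
theorem exists_frameSection [FiniteDimensional ℝ E] [FiniteDimensional ℝ F] [T2Space M]
    [IsManifold I ∞ M] [ContMDiffVectorBundle ∞ F A I] (x : M) (i : Fin (finrank ℝ F)) :
    ∃ s : Sec I F A, ∀ᶠ y in 𝓝 x,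
      s y = (trivializationAt F A x).localFrame (finBasis ℝ F) i y := by
  let e := trivializationAt F A x
  have hmem : e.baseSet ∈ 𝓝 x :=
    e.open_baseSet.mem_nhds (FiberBundle.mem_baseSet_trivializationAt F A x)
  obtain ⟨ψ, hψ, -⟩ := (SmoothBumpFunction.nhds_basis_support (I := I) hmem).mem_iff.1 hmem
  refine ⟨⟨(ψ : M → ℝ) • e.localFrame (finBasis ℝ F) i, ?_⟩, ?_⟩
  · exact ContMDiffOn.smul_section_of_tsupport ψ.contMDiff.contMDiffOn e.open_baseSet hψ
      (e.contMDiffOn_localFrame_baseSet ∞ (finBasis ℝ F) i)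
  · filter_upwards [ψ.eventuallyEq_one] with y hy
    change ψ y • e.localFrame (finBasis ℝ F) i y = _
    rw [hy]
    simp [e]

variable [∀ x, IsTopologicalAddGroup (A x)] [∀ x, ContinuousSMul ℝ (A x)]

variable (I) in
/-- The vertical tangent vector at `p ∈ A*` with direction `η ∈ A*_{π(p)}`: the velocity at `t = 0`
of the curve `t ↦ p + t η`. -/
def verticalVec (p : DualTotal F A) (η : A p.proj →L[ℝ] ℝ) :
    TangentSpace (I.prod 𝓘(ℝ, F →L[ℝ] ℝ)) p :=
  mfderiv 𝓘(ℝ, ℝ) (I.prod 𝓘(ℝ, F →L[ℝ] ℝ))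
    (fun t : ℝ => (⟨p.proj, p.2 + t • η⟩ : DualTotal F A)) 0 (1 : ℝ)

variable (I) in
/-- The Liouville vector field `Δ` of `A*`. -/
def liouville (p : DualTotal F A) : TangentSpace (I.prod 𝓘(ℝ, F →L[ℝ] ℝ)) p :=
  verticalVec I p p.2

/-- The vertical lift `φᵛ` of `φ ∈ Γ(A*)`. -/
def verticalLift (φ : DualSec I F A) (p : DualTotal F A) :
    TangentSpace (I.prod 𝓘(ℝ, F →L[ℝ] ℝ)) p :=
  verticalVec I p (φ p.proj)

/-! ### The linear Poisson bivector of a Lie algebroid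

Near a point `x` we use the frame `e₁, …, eₙ` of `A` given by the trivialization of `A` at `x` and a
basis of the model fibre, and the induced fibre coordinates `μⱼ = ẽⱼ` on `A*`. -/

variable [FiniteDimensional ℝ E] [FiniteDimensional ℝ F] [T2Space M] [IsManifold I ∞ M]
  [ContMDiffVectorBundle ∞ F A I]

variable (I F A) in
/-- A global section which coincides near `x` with the frame element `eᵢ`.  (By the Leibniz rule
the value at `x` of `⟦eᵢ, eⱼ⟧` does not depend on the chosen extensions.) -/
def frameSection (x : M) (i : Fin (finrank ℝ F)) : Sec I F A :=
  (exists_frameSection I F A x i).choose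

variable (F A) in
/-- The element `eⁱ` at `x` of the dual frame. -/
def dualFrame (x : M) (i : Fin (finrank ℝ F)) : A x →L[ℝ] ℝ :=
  (LinearMap.toContinuousLinearMap ((finBasis ℝ F).coord i)).comp
    ((trivializationAt F A x).continuousLinearMapAt ℝ x)

variable (I) in
/-- The tangent vector at `p` with components `u ∈ T_{π(p)} M` along the base coordinates and zero
components along the fibre coordinates `μⱼ`: if `u = ∑ uˡ ∂/∂xˡ` in `M` then this is
`∑ uˡ ∂/∂xˡ` in the fibred coordinates `(xˡ, μⱼ)`. It is the image of `u` under the differential of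
the local section of `A*` through `p` whose fibre coordinates are constant. -/
def horizontalVec (p : DualTotal F A) (u : TangentSpace I p.proj) :
    TangentSpace (I.prod 𝓘(ℝ, F →L[ℝ] ℝ)) p :=
  mfderiv I (I.prod 𝓘(ℝ, F →L[ℝ] ℝ))
    (fun y : M =>
      (trivializationAt (F →L[ℝ] ℝ) (fun x => A x →L[ℝ] ℝ)
        p.proj).toOpenPartialHomeomorph.symm
          (y, (trivializationAt (F →L[ℝ] ℝ) (fun x => A x →L[ℝ] ℝ) p.proj p).2))
    p.proj u

/-- The Poisson bivector `Λ_{A*}` of a Lie algebroid: at `p` over `x` it is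
`∑_{i<j} (∑ₖ c_{ij}ᵏ μₖ) ∂/∂μᵢ ∧ ∂/∂μⱼ + ∑ᵢ ∂/∂μᵢ ∧ (∑ₗ ρᵢˡ ∂/∂xˡ)`,
where `⟦eᵢ, eⱼ⟧ = ∑ₖ c_{ij}ᵏ eₖ` and `ρ(eᵢ) = ∑ₗ ρᵢˡ ∂/∂xˡ`; note that `∑ₖ c_{ij}ᵏ(x) μₖ(p)` is
the value of the covector `p` on `⟦eᵢ, eⱼ⟧(x)`, and that `∂/∂μᵢ` is the vertical vector with
direction `eⁱ`. -/
def LieAlgebroid.dualPoisson (L : LieAlgebroid I F A) (p : DualTotal F A) :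
    Cotangent (I.prod 𝓘(ℝ, F →L[ℝ] ℝ)) p →L[ℝ]
      Cotangent (I.prod 𝓘(ℝ, F →L[ℝ] ℝ)) p →L[ℝ] ℝ :=
  (∑ i : Fin (finrank ℝ F), ∑ j ∈ Finset.Ioi i,
    p.2 (L.bracket (frameSection I F A p.proj i) (frameSection I F A p.proj j) p.proj) •
      wedgeVec (verticalVec I p (dualFrame F A p.proj i))
        (verticalVec I p (dualFrame F A p.proj j)))
  + ∑ i : Fin (finrank ℝ F),
      wedgeVec (verticalVec I p (dualFrame F A p.proj i))
        (horizontalVec I p (L.anchor p.proj (frameSection I F A p.proj i p.proj)))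

/-- The bivector `Λ_{(A*, φ)} = Λ_{A*} + Δ ∧ φᵛ`. -/
def AlgebroidWithCocycle.bivec (a : AlgebroidWithCocycle I F A) (p : DualTotal F A) :
    Cotangent (I.prod 𝓘(ℝ, F →L[ℝ] ℝ)) p →L[ℝ]
      Cotangent (I.prod 𝓘(ℝ, F →L[ℝ] ℝ)) p →L[ℝ] ℝ :=
  a.alg.dualPoisson p + wedgeVec (liouville I p) (verticalLift a.form p)

/-- The vector field `E_{(A*, φ)} = -φᵛ`. -/
def AlgebroidWithCocycle.vec (a : AlgebroidWithCocycle I F A) (p : DualTotal F A) :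
    TangentSpace (I.prod 𝓘(ℝ, F →L[ℝ] ℝ)) p :=
  -verticalLift a.form p

variable (I F A)

/-- The set `𝒥` of Jacobi structures on `A*` such that (C1) the Jacobi bracket of two linear
functions is linear, and (C2) the Jacobi bracket of a linear function and the constant function `1`
is basic. -/
def linearJacobi : Set (JacobiStructure (I.prod 𝓘(ℝ, F →L[ℝ] ℝ)) (DualTotal F A)) :=
  {J | (∀ f g, IsLinearFun I F A f → IsLinearFun I F A g → IsLinearFun I F A (J.bracket f g)) ∧
    ∀ f, IsLinearFun I F A f → IsBasicFun I F A (J.bracket f 1)}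

/-- The set of linear Poisson structures on `A*`: the Poisson bracket of two linear functions is
linear. -/
def linearPoisson : Set (PoissonStructure (I.prod 𝓘(ℝ, F →L[ℝ] ℝ)) (DualTotal F A)) :=
  {P | ∀ f g, IsLinearFun I F A f → IsLinearFun I F A g → IsLinearFun I F A (P.bracket f g)}

end Algebroid

end

noncomputable section

set_option maxSynthPendingDepth 5

/-! ### Smoothness of sections of hom-bundles -/

section HomBundle

variable {EB : Type*} [NormedAddCommGroup EB] [NormedSpace ℝ EB]
  {HB : Type*} [TopologicalSpace HB] {IB : ModelWithCorners ℝ EB HB}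
  {B : Type*} [TopologicalSpace B] [ChartedSpace HB B]

theorem contMDiffAt_clm_of_apply {F₁ F₂ : Type*} [NormedAddCommGroup F₁] [NormedSpace ℝ F₁]
    [FiniteDimensional ℝ F₁] [NormedAddCommGroup F₂] [NormedSpace ℝ F₂] {n : WithTop ℕ∞}
    {f : B → F₁ →L[ℝ] F₂} {x : B}
    (h : ∀ v, ContMDiffAt IB 𝓘(ℝ, F₂) n (fun y => f y v) x) :
    ContMDiffAt IB 𝓘(ℝ, F₁ →L[ℝ] F₂) n f x := by
  let b := finBasis ℝ F₁
  have key : f = fun y => ∑ i, (ContinuousLinearMap.smulRightL ℝ F₁ F₂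
      (LinearMap.toContinuousLinearMap (b.coord i))) (f y (b i)) := by
    funext y
    ext v
    conv_lhs => rw [← b.sum_repr v, map_sum]
    simp
  rw [key]
  refine ContMDiffAt.sum fun i _ => ?_
  exact (ContinuousLinearMap.contMDiff _).contMDiffAt.comp x (h (b i))

variable {F₁ : Type*} [NormedAddCommGroup F₁] [NormedSpace ℝ F₁]
  {E₁ : B → Type*} [∀ x, AddCommGroup (E₁ x)] [∀ x, Module ℝ (E₁ x)]
  [TopologicalSpace (TotalSpace F₁ E₁)] [∀ x, TopologicalSpace (E₁ x)]
  [FiberBundle F₁ E₁] [VectorBundle ℝ F₁ E₁]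
  {F₂ : Type*} [NormedAddCommGroup F₂] [NormedSpace ℝ F₂]
  {E₂ : B → Type*} [∀ x, AddCommGroup (E₂ x)] [∀ x, Module ℝ (E₂ x)]
  [TopologicalSpace (TotalSpace F₂ E₂)] [∀ x, TopologicalSpace (E₂ x)]
  [FiberBundle F₂ E₂] [VectorBundle ℝ F₂ E₂]

/-- A section of a hom-bundle is smooth when it sends the constant sections of a trivialization to
smooth sections. -/
theorem contMDiffAt_homSection_of_apply [FiniteDimensional ℝ F₁]
    [∀ x, IsTopologicalAddGroup (E₂ x)] [∀ x, ContinuousSMul ℝ (E₂ x)] {n : WithTop ℕ∞}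
    {φ : ∀ x, E₁ x →L[ℝ] E₂ x} {x₀ : B}
    (h : ∀ v : F₁, ContMDiffAt IB (IB.prod 𝓘(ℝ, F₂)) n
      (fun x => TotalSpace.mk' F₂ x (φ x ((trivializationAt F₁ E₁ x₀).symmL ℝ x v))) x₀) :
    ContMDiffAt IB (IB.prod 𝓘(ℝ, F₁ →L[ℝ] F₂)) n
      (fun x => TotalSpace.mk' (F₁ →L[ℝ] F₂) (E := fun x => E₁ x →L[ℝ] E₂ x) x (φ x)) x₀ := by
  refine (contMDiffAt_hom_bundle _).2 ⟨contMDiffAt_id, contMDiffAt_clm_of_apply fun v => ?_⟩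
  have := (contMDiffAt_totalSpace.1 (h v)).2
  refine this.congr_of_eventuallyEq ?_
  filter_upwards [(trivializationAt F₂ E₂ x₀).open_baseSet.mem_nhds
    (mem_baseSet_trivializationAt F₂ E₂ x₀)] with y hy
  simp [ContinuousLinearMap.inCoordinates, Trivialization.coe_linearMapAt_of_mem _ hy]

theorem contMDiffAt_trivSymmL [∀ x, IsTopologicalAddGroup (E₁ x)] [∀ x, ContinuousSMul ℝ (E₁ x)]
    {n : WithTop ℕ∞} [ContMDiffVectorBundle n F₁ E₁ IB] (x₀ : B) (v : F₁) {x : B}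
    (hx : x ∈ (trivializationAt F₁ E₁ x₀).baseSet) :
    ContMDiffAt IB (IB.prod 𝓘(ℝ, F₁)) n
      (fun x => TotalSpace.mk' F₁ x ((trivializationAt F₁ E₁ x₀).symmL ℝ x v)) x := by
  rw [(trivializationAt F₁ E₁ x₀).contMDiffAt_section_iff hx]
  refine (contMDiffAt_const (c := v)).congr_of_eventuallyEq ?_
  filter_upwards [(trivializationAt F₁ E₁ x₀).open_baseSet.mem_nhds hx] with y hy
  simp [Trivialization.symmL_apply _ hy, hy]

theorem contMDiff_real_section_iff {n : WithTop ℕ∞} {f : B → ℝ} {x : B} :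
    ContMDiffAt IB (IB.prod 𝓘(ℝ, ℝ)) n
      (fun x => TotalSpace.mk' ℝ (E := fun _ : B => ℝ) x (f x)) x ↔
    ContMDiffAt IB 𝓘(ℝ, ℝ) n f x := by
  rw [contMDiffAt_section]
  rfl

theorem dual_symmL_apply (x₀ : B) {x : B} (hx : x ∈ (trivializationAt F₁ E₁ x₀).baseSet)
    (α : F₁ →L[ℝ] ℝ) :
    (trivializationAt (F₁ →L[ℝ] ℝ) (fun x => E₁ x →L[ℝ] ℝ) x₀).symmL ℝ x α =
      α.comp ((trivializationAt F₁ E₁ x₀).continuousLinearMapAt ℝ x) := by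
  have hx' : x ∈ (trivializationAt (F₁ →L[ℝ] ℝ) (fun x => E₁ x →L[ℝ] ℝ) x₀).baseSet :=
    ⟨hx, mem_univ x⟩
  have key : ((trivializationAt (F₁ →L[ℝ] ℝ) (fun x => E₁ x →L[ℝ] ℝ) x₀)
      ⟨x, α.comp ((trivializationAt F₁ E₁ x₀).continuousLinearMapAt ℝ x)⟩).2 = α := by
    ext v
    rw [hom_trivializationAt_apply]
    simp [ContinuousLinearMap.inCoordinates,
      Trivialization.symmL_apply _ hx, hx]
  rw [Trivialization.symmL_apply _ hx']
  conv_lhs => rw [← key]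
  exact Trivialization.symm_apply_apply_mk _ hx' _

theorem dual_trivialization_apply (x₀ : B) (p : TotalSpace (F₁ →L[ℝ] ℝ) fun x => E₁ x →L[ℝ] ℝ)
    (v : F₁) :
    (trivializationAt (F₁ →L[ℝ] ℝ) (fun x => E₁ x →L[ℝ] ℝ) x₀ p).2 v =
      p.2 ((trivializationAt F₁ E₁ x₀).symmL ℝ p.1 v) := by
  rw [hom_trivializationAt_apply]
  simp [ContinuousLinearMap.inCoordinates]

end HomBundle

/-! ### Vector fields and differentials on a manifold -/

section Manifold

variable {E : Type*} [NormedAddCommGroup E] [NormedSpace ℝ E]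
  {H : Type*} [TopologicalSpace H] {I : ModelWithCorners ℝ E H}
  {N : Type*} [TopologicalSpace N] [ChartedSpace H N]

/-- The tangent vector that represents an element of the bidual of a tangent space. -/
def vectorOfBidual [FiniteDimensional ℝ E] {p : N} (ξ : Cotangent I p →L[ℝ] ℝ) :
    TangentSpace I p :=
  let ξ' : (E →L[ℝ] ℝ) →L[ℝ] ℝ := ξ
  let v : E := ∑ i, ξ' (LinearMap.toContinuousLinearMap ((finBasis ℝ E).coord i)) • finBasis ℝ E i
  v

theorem apply_vectorOfBidual [FiniteDimensional ℝ E] {p : N} (ξ : Cotangent I p →L[ℝ] ℝ)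
    (α : Cotangent I p) : α (vectorOfBidual ξ) = ξ α := by
  let ξ' : (E →L[ℝ] ℝ) →L[ℝ] ℝ := ξ
  let α' : E →L[ℝ] ℝ := α
  change α' (∑ i, ξ' (LinearMap.toContinuousLinearMap ((finBasis ℝ E).coord i)) • finBasis ℝ E i)
    = ξ' α'
  have key : α' = ∑ i, α' (finBasis ℝ E i) •
      LinearMap.toContinuousLinearMap ((finBasis ℝ E).coord i) := by
    ext v
    conv_lhs => rw [← (finBasis ℝ E).sum_repr v, map_sum]
    simp [mul_comm]
  conv_rhs => rw [key, map_sum]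
  simp [mul_comm]

theorem exists_cotangent_ne_zero {p : N} {u : TangentSpace I p} (hu : u ≠ 0) :
    ∃ α : Cotangent I p, α u ≠ 0 := by
  exact SeparatingDual.exists_ne_zero (R := ℝ) (V := E) hu

theorem tangent_ext {p : N} {u v : TangentSpace I p} (h : ∀ α : Cotangent I p, α u = α v) :
    u = v := by
  by_contra hne
  obtain ⟨α, hα⟩ := exists_cotangent_ne_zero (sub_ne_zero.2 hne)
  exact hα (by rw [map_sub, h, sub_self])

variable [IsManifold I ∞ N]

theorem contMDiffAt_tangentSection_of_apply [FiniteDimensional ℝ E]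
    {X : ∀ x : N, TangentSpace I x} {x₀ : N}
    (h : ∀ α : E →L[ℝ] ℝ, ContMDiffAt I 𝓘(ℝ, ℝ) ∞
      (fun x => α ((trivializationAt E (TangentSpace I) x₀).continuousLinearMapAt ℝ x (X x))) x₀) :
    ContMDiffAt I I.tangent ∞ (fun x => (⟨x, X x⟩ : TangentBundle I N)) x₀ := by
  rw [contMDiffAt_section]
  let b := finBasis ℝ E
  have key : ∀ᶠ x in 𝓝 x₀, ((trivializationAt E (TangentSpace I) x₀) ⟨x, X x⟩).2 =
      ∑ i, (LinearMap.toContinuousLinearMap (b.coord i))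
        ((trivializationAt E (TangentSpace I) x₀).continuousLinearMapAt ℝ x (X x)) • b i := by
    filter_upwards [(trivializationAt E (TangentSpace I) x₀).open_baseSet.mem_nhds
      (mem_baseSet_trivializationAt E (TangentSpace I) x₀)] with y hy
    rw [Trivialization.continuousLinearMapAt_apply, Trivialization.coe_linearMapAt_of_mem _ hy]
    exact (b.sum_repr _).symm
  refine ContMDiffAt.congr_of_eventuallyEq ?_ key
  exact ContMDiffAt.sum fun i _ => (h _).smul contMDiffAt_const

theorem contMDiffAt_mvfderiv {f : N → ℝ} {x₀ : N} (hf : ContMDiffAt I 𝓘(ℝ, ℝ) ∞ f x₀) :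
    ContMDiffAt I (I.prod 𝓘(ℝ, E →L[ℝ] ℝ)) ∞
      (fun x => TotalSpace.mk' (E →L[ℝ] ℝ) (E := fun x : N => Cotangent I x) x
        (mvfderiv I f x)) x₀ := by
  refine (contMDiffAt_hom_bundle _).2 ⟨contMDiffAt_id, ?_⟩
  refine (hf.mfderiv_const (m := ∞) (by simp)).congr_of_eventuallyEq ?_
  refine Filter.Eventually.of_forall fun y => ?_
  ext v
  simp [inTangentCoordinates, ContinuousLinearMap.inCoordinates, mvfderiv]
  rfl

theorem contMDiffAt_mvfderiv_apply {f : N → ℝ} {X : ∀ x : N, TangentSpace I x} {x : N}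
    (hf : ContMDiffAt I 𝓘(ℝ, ℝ) ∞ f x)
    (hX : ContMDiffAt I I.tangent ∞ (fun x => (⟨x, X x⟩ : TangentBundle I N)) x) :
    ContMDiffAt I 𝓘(ℝ, ℝ) ∞ (fun y => mvfderiv I f y (X y)) x :=
  contMDiff_real_section_iff.1 ((contMDiffAt_mvfderiv hf).clm_bundle_apply hX)

theorem SmoothVectorField.contMDiff_deriv (X : SmoothVectorField I N) {f : N → ℝ}
    (hf : ContMDiff I 𝓘(ℝ, ℝ) ∞ f) : ContMDiff I 𝓘(ℝ, ℝ) ∞ (X.deriv f) :=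
  fun x => contMDiffAt_mvfderiv_apply (hf x) (X.contMDiff x)

theorem BivectorField.contMDiffAt_apply (P : BivectorField I N)
    {α β : ∀ x : N, Cotangent I x} {x : N}
    (hα : ContMDiffAt I (I.prod 𝓘(ℝ, E →L[ℝ] ℝ)) ∞
      (fun x => TotalSpace.mk' (E →L[ℝ] ℝ) (E := fun x : N => Cotangent I x) x (α x)) x)
    (hβ : ContMDiffAt I (I.prod 𝓘(ℝ, E →L[ℝ] ℝ)) ∞
      (fun x => TotalSpace.mk' (E →L[ℝ] ℝ) (E := fun x : N => Cotangent I x) x (β x)) x) :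
    ContMDiffAt I 𝓘(ℝ, ℝ) ∞ (fun y => P.toSection y (α y) (β y)) x :=
  contMDiff_real_section_iff.1 ((P.toSection.contMDiff x).clm_bundle_apply₂ hα hβ)

theorem BivectorField.contMDiff_onDiff (P : BivectorField I N) {f g : N → ℝ}
    (hf : ContMDiff I 𝓘(ℝ, ℝ) ∞ f) (hg : ContMDiff I 𝓘(ℝ, ℝ) ∞ g) :
    ContMDiff I 𝓘(ℝ, ℝ) ∞ (P.onDiff f g) :=
  fun x => P.contMDiffAt_apply (contMDiffAt_mvfderiv (hf x)) (contMDiffAt_mvfderiv (hg x))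

theorem BivectorField.swap (P : BivectorField I N) (p : N) (α β : Cotangent I p) :
    P.toSection p α β = - P.toSection p β α := by
  have h := P.alternating p (α + β)
  simp only [map_add, add_apply, P.alternating] at h
  linarith

theorem BivectorField.onDiff_swap (P : BivectorField I N) (f g : N → ℝ) :
    P.onDiff f g = - P.onDiff g f :=
  funext fun _ => P.swap _ _ _

/-- The vector field `Λ(·, dg)`. -/
def BivectorField.hamiltonian [FiniteDimensional ℝ E] (P : BivectorField I N) (g : N → ℝ) (p : N) :
    TangentSpace I p :=
  let P' : (E →L[ℝ] ℝ) →L[ℝ] (E →L[ℝ] ℝ) →L[ℝ] ℝ := P.toSection p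
  vectorOfBidual (p := p) (P'.flip (mvfderiv I g p))

theorem BivectorField.apply_hamiltonian [FiniteDimensional ℝ E] (P : BivectorField I N)
    (g : N → ℝ) (p : N) (α : Cotangent I p) :
    α (P.hamiltonian g p) = P.toSection p α (mvfderiv I g p) := by
  exact apply_vectorOfBidual _ α

theorem BivectorField.contMDiff_hamiltonian [FiniteDimensional ℝ E] (P : BivectorField I N)
    {g : N → ℝ} (hg : ContMDiff I 𝓘(ℝ, ℝ) ∞ g) :
    ContMDiff I I.tangent ∞ (fun x => (⟨x, P.hamiltonian g x⟩ : TangentBundle I N)) := by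
  intro x₀
  refine contMDiffAt_tangentSection_of_apply fun α => ?_
  have hs := contMDiffAt_trivSymmL (IB := I) (n := ∞) (F₁ := E →L[ℝ] ℝ)
    (E₁ := fun x : N => Cotangent I x) x₀ α (mem_baseSet_trivializationAt _ _ _)
  refine (P.contMDiffAt_apply hs (contMDiffAt_mvfderiv (hg x₀))).congr_of_eventuallyEq ?_
  filter_upwards [(trivializationAt E (TangentSpace I) x₀).open_baseSet.mem_nhds
      (mem_baseSet_trivializationAt E (TangentSpace I) x₀)] with y hy
  rw [← P.apply_hamiltonian]
  rw [dual_symmL_apply x₀ hy α]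
  rfl

theorem sub_smul_eq_zero_of_expansions {V : Type*} [AddCommGroup V] [Module ℝ V]
    {a a' a'' b c d : ℝ} {w p q r s : V}
    (h : a • w + b • p + (c • q + d • (r + s)) =
      a' • w + d • r + (a'' • w + c • q + (b • p + d • s))) :
    (a' - (a - a'')) • w = 0 := by
  rw [eq_comm, ← sub_eq_zero] at h
  rw [← h]
  module

/-- The commutator formula `[X, Y] f = X (Y f) - Y (X f)`. -/
theorem mvfderiv_mlieBracket [CompleteSpace E] {X Y : ∀ x : N, TangentSpace I x} {f : N → ℝ}
    (hX : ContMDiff I I.tangent ∞ (fun x => (⟨x, X x⟩ : TangentBundle I N)))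
    (hY : ContMDiff I I.tangent ∞ (fun x => (⟨x, Y x⟩ : TangentBundle I N)))
    (hf : ContMDiff I 𝓘(ℝ, ℝ) ∞ f) (x : N) :
    mvfderiv I f x (VectorField.mlieBracket I X Y x) =
      mvfderiv I (fun y => mvfderiv I f y (Y y)) x (X x) -
        mvfderiv I (fun y => mvfderiv I f y (X y)) x (Y x) := by
  rcases subsingleton_or_nontrivial E with hE | hE
  · have : ∀ u : TangentSpace I x, u = 0 := fun u => Subsingleton.elim (α := E) _ _
    rw [this (VectorField.mlieBracket I X Y x), this (X x), this (Y x)]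
    simp
  obtain ⟨w, hw⟩ := exists_ne (0 : E)
  have hmf : ∀ y, MDifferentiableAt I 𝓘(ℝ, ℝ) f y := fun y => (hf y).mdifferentiableAt (by simp)
  let W : ∀ y : N, TangentSpace I y :=
    FiberBundle.extend E (E := fun y : N => TangentSpace I y) (x := x) w
  have hWx : W x = w :=
    FiberBundle.extend_apply_self (F := E) (E := fun y : N => TangentSpace I y) (x := x) w
  obtain ⟨s, hs, hWs⟩ := FiberBundle.exists_contMDiffOn_extend (k := ∞) I E
    (V := fun y : N => TangentSpace I y) (x₀ := x) w
  have hW : ∀ᶠ y in 𝓝 x, ContMDiffAt I I.tangent ∞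
      (fun x => (⟨x, W x⟩ : TangentBundle I N)) y := by
    filter_upwards [eventually_mem_nhds_iff.2 hs] with y hy
    exact hWs.contMDiffAt hy
  have h3 : IsManifold I (minSmoothness ℝ 3) N := by
    rw [minSmoothness_of_isRCLikeNormedField]
    exact IsManifold.of_le (n := ∞) (by exact WithTop.coe_le_coe.2 le_top)
  have h2 : IsManifold I ((2 : ℕ∞) + 1 : WithTop ℕ∞) N :=
    IsManifold.of_le (n := ∞) (by exact WithTop.coe_le_coe.2 le_top)
  have hbr : ∀ {Z : ∀ x : N, TangentSpace I x},
      ContMDiff I I.tangent ∞ (fun x => (⟨x, Z x⟩ : TangentBundle I N)) →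
      MDifferentiableAt I I.tangent
        (fun y => (⟨y, VectorField.mlieBracket I Z W y⟩ : TangentBundle I N)) x := by
    intro Z hZ
    refine (ContMDiffAt.mlieBracket_vectorField (m := 1) (n := 2)
      ((hZ x).of_le ?_) (hW.self_of_nhds.of_le ?_) ?_).mdifferentiableAt (by simp)
    · exact WithTop.coe_le_coe.2 le_top
    · exact WithTop.coe_le_coe.2 le_top
    · rw [minSmoothness_of_isRCLikeNormedField]; norm_cast
  have hWd : ∀ᶠ y in 𝓝 x, MDifferentiableAt I I.tangent
      (fun x => (⟨x, W x⟩ : TangentBundle I N)) y :=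
    hW.mono fun y hy => hy.mdifferentiableAt (by simp)
  have hZf : ∀ {Z : ∀ x : N, TangentSpace I x},
      ContMDiff I I.tangent ∞ (fun x => (⟨x, Z x⟩ : TangentBundle I N)) →
      MDifferentiableAt I 𝓘(ℝ, ℝ) (fun y => mvfderiv I f y (Z y)) x := fun hZ =>
    (contMDiffAt_mvfderiv_apply (hf x) (hZ x)).mdifferentiableAt (by simp)
  have double : ∀ {U Z : ∀ x : N, TangentSpace I x},
      ContMDiff I I.tangent ∞ (fun x => (⟨x, U x⟩ : TangentBundle I N)) →
      ContMDiff I I.tangent ∞ (fun x => (⟨x, Z x⟩ : TangentBundle I N)) →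
      VectorField.mlieBracket I U (VectorField.mlieBracket I Z (f • W)) x =
        mvfderiv I (fun y => mvfderiv I f y (Z y)) x (U x) • W x
        + mvfderiv I f x (Z x) • VectorField.mlieBracket I U W x
        + (mvfderiv I f x (U x) • VectorField.mlieBracket I Z W x
        + f x • VectorField.mlieBracket I U (VectorField.mlieBracket I Z W) x) := by
    intro U Z hU hZ
    have e : VectorField.mlieBracket I Z (f • W) =ᶠ[𝓝 x]
        (fun y => mvfderiv I f y (Z y)) • W + f • VectorField.mlieBracket I Z W := by
      filter_upwards [hWd] with y hy
      exact VectorField.mlieBracket_smul_right (hmf y) hy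
    rw [(Filter.EventuallyEq.refl _ U).mlieBracket_vectorField_eq e,
      VectorField.mlieBracket_add_right ((hZf hZ).smul_section hWd.self_of_nhds)
        ((hmf x).smul_section (hbr hZ)),
      VectorField.mlieBracket_smul_right (hZf hZ) hWd.self_of_nhds,
      VectorField.mlieBracket_smul_right (hmf x) (hbr hZ)]
  have l1 := VectorField.leibniz_identity_mlieBracket_apply (I := I) (U := X) (V := Y) (W := W)
    (x := x) ((hX x).of_le (by simp; exact WithTop.coe_le_coe.2 le_top))
    ((hY x).of_le (by simp; exact WithTop.coe_le_coe.2 le_top))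
    (hW.self_of_nhds.of_le (by simp; exact WithTop.coe_le_coe.2 le_top))
  have l2 := VectorField.leibniz_identity_mlieBracket_apply (I := I) (U := X) (V := Y) (W := f • W)
    (x := x) ((hX x).of_le (by simp; exact WithTop.coe_le_coe.2 le_top))
    ((hY x).of_le (by simp; exact WithTop.coe_le_coe.2 le_top))
    (((hf x).smul_section hW.self_of_nhds).of_le (by simp; exact WithTop.coe_le_coe.2 le_top))
  rw [double hX hY, double hY hX, VectorField.mlieBracket_smul_right (hmf x) hWd.self_of_nhds,
    l1, hWx] at l2
  have l3 := sub_smul_eq_zero_of_expansions (V := E) l2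
  exact sub_eq_zero.1 ((smul_eq_zero.1 l3).resolve_right hw)

end Manifold

/-! ### Tensoriality of the Schouten brackets -/

section Schouten

variable {E : Type*} [NormedAddCommGroup E] [NormedSpace ℝ E]
  {H : Type*} [TopologicalSpace H] {I : ModelWithCorners ℝ E H}
  {N : Type*} [TopologicalSpace N] [ChartedSpace H N]

theorem mvfderiv_add_apply {f g : N → ℝ} (hf : ContMDiff I 𝓘(ℝ, ℝ) ∞ f)
    (hg : ContMDiff I 𝓘(ℝ, ℝ) ∞ g) (p : N) :
    mvfderiv I (f + g) p = mvfderiv I f p + mvfderiv I g p :=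
  mvfderiv_add ((hf p).mdifferentiableAt (by simp)) ((hg p).mdifferentiableAt (by simp))

theorem mvfderiv_mul_apply {f g : N → ℝ} (hf : ContMDiff I 𝓘(ℝ, ℝ) ∞ f)
    (hg : ContMDiff I 𝓘(ℝ, ℝ) ∞ g) (p : N) :
    mvfderiv I (f * g) p = f p • mvfderiv I g p + g p • mvfderiv I f p :=
  mvfderiv_mul ((hf p).mdifferentiableAt (by simp)) ((hg p).mdifferentiableAt (by simp))

theorem mvfderiv_sub_apply {f g : N → ℝ} (hf : ContMDiff I 𝓘(ℝ, ℝ) ∞ f)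
    (hg : ContMDiff I 𝓘(ℝ, ℝ) ∞ g) (p : N) :
    mvfderiv I (f - g) p = mvfderiv I f p - mvfderiv I g p :=
  mvfderiv_sub ((hf p).mdifferentiableAt (by simp)) ((hg p).mdifferentiableAt (by simp))

variable [IsManifold I ∞ N]

theorem SmoothVectorField.deriv_add (X : SmoothVectorField I N) {f g : N → ℝ}
    (hf : ContMDiff I 𝓘(ℝ, ℝ) ∞ f) (hg : ContMDiff I 𝓘(ℝ, ℝ) ∞ g) :
    X.deriv (f + g) = X.deriv f + X.deriv g := by
  funext p
  simp [SmoothVectorField.deriv, mvfderiv_add_apply hf hg]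

theorem SmoothVectorField.deriv_sub (X : SmoothVectorField I N) {f g : N → ℝ}
    (hf : ContMDiff I 𝓘(ℝ, ℝ) ∞ f) (hg : ContMDiff I 𝓘(ℝ, ℝ) ∞ g) :
    X.deriv (f - g) = X.deriv f - X.deriv g := by
  funext p
  simp [SmoothVectorField.deriv, mvfderiv_sub_apply hf hg]

theorem SmoothVectorField.deriv_neg (X : SmoothVectorField I N) (f : N → ℝ) :
    X.deriv (-f) = -X.deriv f := by
  funext p
  simp [SmoothVectorField.deriv, mvfderiv_neg]

theorem SmoothVectorField.deriv_mul (X : SmoothVectorField I N) {f g : N → ℝ}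
    (hf : ContMDiff I 𝓘(ℝ, ℝ) ∞ f) (hg : ContMDiff I 𝓘(ℝ, ℝ) ∞ g) :
    X.deriv (f * g) = f * X.deriv g + g * X.deriv f := by
  funext p
  simp [SmoothVectorField.deriv, mvfderiv_mul_apply hf hg]

theorem BivectorField.onDiff_add_left (P : BivectorField I N) {f g : N → ℝ}
    (hf : ContMDiff I 𝓘(ℝ, ℝ) ∞ f) (hg : ContMDiff I 𝓘(ℝ, ℝ) ∞ g) (h : N → ℝ) :
    P.onDiff (f + g) h = P.onDiff f h + P.onDiff g h := by
  funext p
  simp [BivectorField.onDiff, mvfderiv_add_apply hf hg]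

theorem BivectorField.onDiff_sub_left (P : BivectorField I N) {f g : N → ℝ}
    (hf : ContMDiff I 𝓘(ℝ, ℝ) ∞ f) (hg : ContMDiff I 𝓘(ℝ, ℝ) ∞ g) (h : N → ℝ) :
    P.onDiff (f - g) h = P.onDiff f h - P.onDiff g h := by
  funext p
  simp [BivectorField.onDiff, mvfderiv_sub_apply hf hg]

theorem BivectorField.onDiff_neg_left (P : BivectorField I N) (f h : N → ℝ) :
    P.onDiff (-f) h = -P.onDiff f h := by
  funext p
  simp [BivectorField.onDiff, mvfderiv_neg]

theorem BivectorField.onDiff_mul_left (P : BivectorField I N) {f g : N → ℝ}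
    (hf : ContMDiff I 𝓘(ℝ, ℝ) ∞ f) (hg : ContMDiff I 𝓘(ℝ, ℝ) ∞ g) (h : N → ℝ) :
    P.onDiff (f * g) h = f * P.onDiff g h + g * P.onDiff f h := by
  funext p
  simp [BivectorField.onDiff, mvfderiv_mul_apply hf hg]

theorem BivectorField.onDiff_add_right (P : BivectorField I N) {f g : N → ℝ}
    (hf : ContMDiff I 𝓘(ℝ, ℝ) ∞ f) (hg : ContMDiff I 𝓘(ℝ, ℝ) ∞ g) (h : N → ℝ) :
    P.onDiff h (f + g) = P.onDiff h f + P.onDiff h g := by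
  funext p
  simp [BivectorField.onDiff, mvfderiv_add_apply hf hg]

theorem BivectorField.onDiff_mul_right (P : BivectorField I N) {f g : N → ℝ}
    (hf : ContMDiff I 𝓘(ℝ, ℝ) ∞ f) (hg : ContMDiff I 𝓘(ℝ, ℝ) ∞ g) (h : N → ℝ) :
    P.onDiff h (f * g) = f * P.onDiff h g + g * P.onDiff h f := by
  funext p
  simp [BivectorField.onDiff, mvfderiv_mul_apply hf hg]

variable [FiniteDimensional ℝ E]

theorem BivectorField.onDiff_eq_hamiltonian (P : BivectorField I N) (f g : N → ℝ) :
    P.onDiff f g = fun y => mvfderiv I f y (P.hamiltonian g y) :=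
  funext fun p => (P.apply_hamiltonian g p (mvfderiv I f p)).symm

theorem schoutenBivector_self_apply (P : BivectorField I N) {f g h : N → ℝ}
    (hf : ContMDiff I 𝓘(ℝ, ℝ) ∞ f) (hg : ContMDiff I 𝓘(ℝ, ℝ) ∞ g)
    (hh : ContMDiff I 𝓘(ℝ, ℝ) ∞ h) (p : N) :
    schoutenBivector P P f g h p =
      2 * (mvfderiv I f p (VectorField.mlieBracket I (P.hamiltonian h) (P.hamiltonian g) p)
        + P.toSection p (mvfderiv I (P.onDiff g h) p) (mvfderiv I f p)) := by
  have : CompleteSpace E := FiniteDimensional.complete ℝ E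
  rw [mvfderiv_mlieBracket (P.contMDiff_hamiltonian hh) (P.contMDiff_hamiltonian hg) hf,
    ← P.onDiff_eq_hamiltonian, ← P.onDiff_eq_hamiltonian, P.apply_hamiltonian,
    P.apply_hamiltonian]
  simp only [schoutenBivector, Pi.add_apply, P.onDiff_swap h f, P.onDiff_neg_left, Pi.neg_apply]
  simp only [BivectorField.onDiff]
  ring

theorem schoutenBivector_congr_left (P : BivectorField I N) {f f' g h : N → ℝ}
    (hf : ContMDiff I 𝓘(ℝ, ℝ) ∞ f) (hf' : ContMDiff I 𝓘(ℝ, ℝ) ∞ f')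
    (hg : ContMDiff I 𝓘(ℝ, ℝ) ∞ g) (hh : ContMDiff I 𝓘(ℝ, ℝ) ∞ h) {p : N}
    (e : mvfderiv I f p = mvfderiv I f' p) :
    schoutenBivector P P f g h p = schoutenBivector P P f' g h p := by
  rw [schoutenBivector_self_apply P hf hg hh, schoutenBivector_self_apply P hf' hg hh, e]

omit [FiniteDimensional ℝ E] in
theorem schoutenBivector_cyclic (P : BivectorField I N) (f g h : N → ℝ) :
    schoutenBivector P P f g h = schoutenBivector P P g h f := by
  simp only [schoutenBivector]
  abel

/-- The Schouten bracket `[Λ, Λ]` at a point depends only on the differentials at that point. -/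
theorem schoutenBivector_congr (P : BivectorField I N) {f f' g g' h h' : N → ℝ}
    (hf : ContMDiff I 𝓘(ℝ, ℝ) ∞ f) (hf' : ContMDiff I 𝓘(ℝ, ℝ) ∞ f')
    (hg : ContMDiff I 𝓘(ℝ, ℝ) ∞ g) (hg' : ContMDiff I 𝓘(ℝ, ℝ) ∞ g')
    (hh : ContMDiff I 𝓘(ℝ, ℝ) ∞ h) (hh' : ContMDiff I 𝓘(ℝ, ℝ) ∞ h') {p : N}
    (ef : mvfderiv I f p = mvfderiv I f' p) (eg : mvfderiv I g p = mvfderiv I g' p)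
    (eh : mvfderiv I h p = mvfderiv I h' p) :
    schoutenBivector P P f g h p = schoutenBivector P P f' g' h' p := by
  rw [schoutenBivector_congr_left P hf hf' hg hh ef, schoutenBivector_cyclic,
    schoutenBivector_congr_left P hg hg' hh hf' eg, schoutenBivector_cyclic,
    schoutenBivector_congr_left P hh hh' hf' hg' eh, schoutenBivector_cyclic]

theorem schoutenVector_apply (X : SmoothVectorField I N) (P : BivectorField I N) {f g : N → ℝ}
    (hf : ContMDiff I 𝓘(ℝ, ℝ) ∞ f) (hg : ContMDiff I 𝓘(ℝ, ℝ) ∞ g) (p : N) :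
    schoutenVector X P f g p =
      mvfderiv I f p (VectorField.mlieBracket I X (P.hamiltonian g) p)
        - P.toSection p (mvfderiv I f p) (mvfderiv I (X.deriv g) p) := by
  have : CompleteSpace E := FiniteDimensional.complete ℝ E
  rw [mvfderiv_mlieBracket X.contMDiff (P.contMDiff_hamiltonian hg) hf,
    ← P.onDiff_eq_hamiltonian, P.apply_hamiltonian]
  rfl

omit [FiniteDimensional ℝ E] in
theorem schoutenVector_swap (X : SmoothVectorField I N) (P : BivectorField I N) (f g : N → ℝ) :
    schoutenVector X P f g = -schoutenVector X P g f := by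
  simp only [schoutenVector, P.onDiff_swap f, P.onDiff_swap _ g, X.deriv_neg]
  abel

theorem schoutenVector_congr (X : SmoothVectorField I N) (P : BivectorField I N)
    {f f' g g' : N → ℝ}
    (hf : ContMDiff I 𝓘(ℝ, ℝ) ∞ f) (hf' : ContMDiff I 𝓘(ℝ, ℝ) ∞ f')
    (hg : ContMDiff I 𝓘(ℝ, ℝ) ∞ g) (hg' : ContMDiff I 𝓘(ℝ, ℝ) ∞ g') {p : N}
    (ef : mvfderiv I f p = mvfderiv I f' p) (eg : mvfderiv I g p = mvfderiv I g' p) :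
    schoutenVector X P f g p = schoutenVector X P f' g' p := by
  rw [schoutenVector_apply X P hf hg, ef, ← schoutenVector_apply X P hf' hg,
    schoutenVector_swap, Pi.neg_apply, schoutenVector_apply X P hg hf', eg,
    ← schoutenVector_apply X P hg' hf', schoutenVector_swap, Pi.neg_apply, neg_neg]

omit [FiniteDimensional ℝ E] in
/-- The Jacobi identity of the Jacobi bracket. -/
theorem JacobiStructure.bracket_jacobi (J : JacobiStructure I N) {f g h : N → ℝ}
    (hf : ContMDiff I 𝓘(ℝ, ℝ) ∞ f) (hg : ContMDiff I 𝓘(ℝ, ℝ) ∞ g)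
    (hh : ContMDiff I 𝓘(ℝ, ℝ) ∞ h) :
    J.bracket (J.bracket f g) h + J.bracket (J.bracket g h) f + J.bracket (J.bracket h f) g = 0 := by
  have expand : ∀ {f g h : N → ℝ}, ContMDiff I 𝓘(ℝ, ℝ) ∞ f → ContMDiff I 𝓘(ℝ, ℝ) ∞ g →
      J.bracket (J.bracket f g) h =
        J.Lam.onDiff (J.Lam.onDiff f g) h
        + (f * J.Lam.onDiff (J.vec.deriv g) h + J.vec.deriv g * J.Lam.onDiff f h)
        - (g * J.Lam.onDiff (J.vec.deriv f) h + J.vec.deriv f * J.Lam.onDiff g h)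
        + (J.Lam.onDiff f g + f * J.vec.deriv g - g * J.vec.deriv f) * J.vec.deriv h
        - h * (J.vec.deriv (J.Lam.onDiff f g)
          + (f * J.vec.deriv (J.vec.deriv g) + J.vec.deriv g * J.vec.deriv f)
          - (g * J.vec.deriv (J.vec.deriv f) + J.vec.deriv f * J.vec.deriv g)) := by
    intro f g h hf hg
    have h1 := J.Lam.contMDiff_onDiff hf hg
    have h2 := J.vec.contMDiff_deriv hf
    have h3 := J.vec.contMDiff_deriv hg
    have h4 : ContMDiff I 𝓘(ℝ, ℝ) ∞ (f * J.vec.deriv g) := hf.mul h3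
    have h5 : ContMDiff I 𝓘(ℝ, ℝ) ∞ (g * J.vec.deriv f) := hg.mul h2
    have h6 : ContMDiff I 𝓘(ℝ, ℝ) ∞ (J.Lam.onDiff f g + f * J.vec.deriv g) := h1.add h4
    simp only [JacobiStructure.bracket]
    rw [J.Lam.onDiff_sub_left h6 h5, J.Lam.onDiff_add_left h1 h4, J.Lam.onDiff_mul_left hf h3,
      J.Lam.onDiff_mul_left hg h2, J.vec.deriv_sub h6 h5, J.vec.deriv_add h1 h4,
      J.vec.deriv_mul hf h3, J.vec.deriv_mul hg h2]
  have s1 := J.schouten_self f g h hf hg hh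
  have v1 := J.schouten_vec f g hf hg
  have v2 := J.schouten_vec g h hg hh
  have v3 := J.schouten_vec h f hh hf
  rw [expand hf hg, expand hg hh, expand hh hf]
  funext p
  have s1 := congrFun s1 p
  have v1 := congrFun v1 p
  have v2 := congrFun v2 p
  have v3 := congrFun v3 p
  simp only [schoutenVector, schoutenBivector, wedgeVectorBivector,
    J.Lam.onDiff_swap f (J.vec.deriv _), J.Lam.onDiff_swap g (J.vec.deriv _),
    J.Lam.onDiff_swap h (J.vec.deriv _)] at s1 v1 v2 v3
  simp only [J.Lam.onDiff_swap f h, J.Lam.onDiff_swap g f, J.Lam.onDiff_swap h g]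
  simp only [Pi.add_apply, Pi.sub_apply, Pi.mul_apply, Pi.neg_apply,
    Pi.ofNat_apply] at *
  linear_combination (1 / 2) * s1 - h p * v1 - f p * v2 - g p * v3

end Schouten

/-! ### Smooth sections, functions and the total space of the dual bundle -/

section Chart

variable {E : Type*} [NormedAddCommGroup E] [NormedSpace ℝ E]
  {H : Type*} [TopologicalSpace H] {I : ModelWithCorners ℝ E H}
  {N : Type*} [TopologicalSpace N] [ChartedSpace H N]

theorem mvfderiv_congr_of_eventuallyEq {f g : N → ℝ} {p : N} (h : f =ᶠ[𝓝 p] g) :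
    mvfderiv I f p = mvfderiv I g p := by
  have := h.mfderiv_eq (I := I) (I' := 𝓘(ℝ, ℝ))
  ext v
  exact congrArg (fun L => (show E →L[ℝ] ℝ from L) v) this

variable [IsManifold I ∞ N]

theorem mvfderiv_comp_extChartAt (x : N) (α : E →L[ℝ] ℝ) {y : N} (hy : y ∈ (chartAt H x).source) :
    mvfderiv I (fun y => α (extChartAt I x y)) y =
      α.comp ((trivializationAt E (TangentSpace I) x).continuousLinearMapAt ℝ y) := by
  have h1 : IsManifold I 1 N := IsManifold.of_le (n := ∞) (by exact WithTop.coe_le_coe.2 le_top)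
  rw [TangentBundle.continuousLinearMapAt_trivializationAt hy]
  have h := mfderiv_comp (I := I) (I' := 𝓘(ℝ, E)) (I'' := 𝓘(ℝ, ℝ)) y (g := α)
    (f := extChartAt I x) α.mdifferentiableAt (mdifferentiableAt_extChartAt hy)
  rw [ContinuousLinearMap.mfderiv_eq] at h
  ext v
  exact congrArg (fun L => (show E →L[ℝ] ℝ from L) v) h

/-- A bivector field is determined by a field of alternating forms whose components in every chart
are smooth. -/
def BivectorField.ofContMDiffAt [FiniteDimensional ℝ E]
    (P : ∀ p : N, Cotangent I p →L[ℝ] Cotangent I p →L[ℝ] ℝ) (hP : ∀ p α, P p α α = 0)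
    (h : ∀ (p₀ : N) (α β : E →L[ℝ] ℝ), ContMDiffAt I 𝓘(ℝ, ℝ) ∞ (fun p =>
      P p (α.comp ((trivializationAt E (TangentSpace I) p₀).continuousLinearMapAt ℝ p))
        (β.comp ((trivializationAt E (TangentSpace I) p₀).continuousLinearMapAt ℝ p))) p₀) :
    BivectorField I N where
  toSection := ⟨P, by
    intro p₀
    refine contMDiffAt_homSection_of_apply fun α => ?_
    refine contMDiffAt_homSection_of_apply fun β => ?_
    refine contMDiff_real_section_iff.2 ((h p₀ α β).congr_of_eventuallyEq ?_)
    filter_upwards [(trivializationAt E (TangentSpace I) p₀).open_baseSet.mem_nhds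
      (mem_baseSet_trivializationAt _ _ p₀)] with p hp
    have hα := dual_symmL_apply p₀ hp α
    have hβ := dual_symmL_apply p₀ hp β
    rw [← hα, ← hβ]⟩
  alternating := hP

theorem BivectorField.ext_apply {P Q : BivectorField I N}
    (h : ∀ p (α β : Cotangent I p), P.toSection p α β = Q.toSection p α β) : P = Q := by
  have key : P.toSection = Q.toSection :=
    ContMDiffSection.ext fun p => ContinuousLinearMap.ext fun α =>
      ContinuousLinearMap.ext fun β => h p α β
  cases P
  cases Q
  congr

end Chart

section Extension

variable {E : Type*} [NormedAddCommGroup E] [NormedSpace ℝ E] [FiniteDimensional ℝ E]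
  {H : Type*} [TopologicalSpace H] {I : ModelWithCorners ℝ E H}
  {M : Type*} [TopologicalSpace M] [ChartedSpace H M] [T2Space M] [IsManifold I ∞ M]

theorem exists_contMDiffMap_eventuallyEq {f : M → ℝ} {u : Set M} (hu : IsOpen u) {x : M}
    (hx : x ∈ u) (hf : ContMDiffOn I 𝓘(ℝ, ℝ) ∞ f u) :
    ∃ g : C^∞⟮I, M; 𝓘(ℝ, ℝ), ℝ⟯, ∀ᶠ y in 𝓝 x, g y = f y := by
  have hmem : u ∈ 𝓝 x := hu.mem_nhds hx
  obtain ⟨ψ, hψ, -⟩ := (SmoothBumpFunction.nhds_basis_support (I := I) hmem).mem_iff.1 hmem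
  refine ⟨⟨fun y => ψ y * f y, ?_⟩, ?_⟩
  · exact contMDiff_of_tsupport fun y hy =>
      ψ.contMDiff.contMDiffAt.mul
        (hf.contMDiffAt (hu.mem_nhds (hψ (tsupport_mul_subset_left hy))))
  · filter_upwards [ψ.eventuallyEq_one] with y hy
    change ψ y * f y = _
    rw [hy]
    simp

variable (I) in
theorem exists_bump_eq_zero {u : Set M} {x : M} (hu : u ∈ 𝓝 x) :
    ∃ g : C^∞⟮I, M; 𝓘(ℝ, ℝ), ℝ⟯, g x = 1 ∧ ∀ y ∉ u, g y = 0 := by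
  obtain ⟨ψ, hψ, -⟩ := (SmoothBumpFunction.nhds_basis_support (I := I) hu).mem_iff.1 hu
  refine ⟨⟨ψ, ψ.contMDiff⟩, ψ.eq_one, fun y hy => ?_⟩
  by_contra h
  exact hy (hψ (subset_tsupport _ h))

theorem exists_contMDiffMap_eq_extChartAt (x : M) (α : E →L[ℝ] ℝ) :
    ∃ f : C^∞⟮I, M; 𝓘(ℝ, ℝ), ℝ⟯, ∀ᶠ y in 𝓝 x, f y = α (extChartAt I x y) := by
  refine exists_contMDiffMap_eventuallyEq (chartAt H x).open_source (mem_chart_source H x) ?_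
  exact α.contMDiff.comp_contMDiffOn contMDiffOn_extChartAt

theorem exists_contMDiffMap_mvfderiv_eq (x : M) (α : Cotangent I x) :
    ∃ f : C^∞⟮I, M; 𝓘(ℝ, ℝ), ℝ⟯, mvfderiv I f x = α := by
  have hx : x ∈ (trivializationAt E (TangentSpace I) x).baseSet :=
    mem_baseSet_trivializationAt E (TangentSpace I) x
  obtain ⟨f, hf⟩ := exists_contMDiffMap_eq_extChartAt (I := I) x
    (α.comp ((trivializationAt E (TangentSpace I) x).symmL ℝ x))
  refine ⟨f, ?_⟩
  rw [mvfderiv_congr_of_eventuallyEq hf, mvfderiv_comp_extChartAt _ _ (mem_chart_source H x)]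
  ext v
  exact congrArg α (Trivialization.symmL_continuousLinearMapAt _ hx v)

variable {F : Type*} [NormedAddCommGroup F] [NormedSpace ℝ F]
  {A : M → Type*} [TopologicalSpace (TotalSpace F A)]
  [∀ x, AddCommGroup (A x)] [∀ x, Module ℝ (A x)] [∀ x, TopologicalSpace (A x)]
  [FiberBundle F A] [VectorBundle ℝ F A]

theorem exists_sec_eventuallyEq {s : ∀ y, A y} {u : Set M} (hu : IsOpen u) {x : M} (hx : x ∈ u)
    (hs : ContMDiffOn I (I.prod 𝓘(ℝ, F)) ∞ (fun y => TotalSpace.mk' F y (s y)) u) :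
    ∃ σ : Sec I F A, ∀ᶠ y in 𝓝 x, σ y = s y := by
  have hmem : u ∈ 𝓝 x := hu.mem_nhds hx
  obtain ⟨ψ, hψ, -⟩ := (SmoothBumpFunction.nhds_basis_support (I := I) hmem).mem_iff.1 hmem
  refine ⟨⟨(ψ : M → ℝ) • s, ?_⟩, ?_⟩
  · exact ContMDiffOn.smul_section_of_tsupport ψ.contMDiff.contMDiffOn hu hψ hs
  · filter_upwards [ψ.eventuallyEq_one] with y hy
    change ψ y • s y = _
    rw [hy]
    simp

variable [∀ x, IsTopologicalAddGroup (A x)] [∀ x, ContinuousSMul ℝ (A x)]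
  [ContMDiffVectorBundle ∞ F A I]

variable (I A) in
theorem exists_sec_trivialization (x : M) (v : F) :
    ∃ σ : Sec I F A, ∀ᶠ y in 𝓝 x, σ y = (trivializationAt F A x).symmL ℝ y v :=
  exists_sec_eventuallyEq (trivializationAt F A x).open_baseSet
    (mem_baseSet_trivializationAt F A x)
    fun _ hy => (contMDiffAt_trivSymmL x v hy).contMDiffWithinAt

variable (I F) in
theorem exists_sec_apply_eq (x : M) (v : A x) : ∃ σ : Sec I F A, σ x = v := by
  obtain ⟨σ, hσ⟩ := exists_sec_trivialization I A x
    ((trivializationAt F A x).continuousLinearMapAt ℝ x v)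
  refine ⟨σ, hσ.self_of_nhds.trans ?_⟩
  exact Trivialization.symmL_continuousLinearMapAt _ (mem_baseSet_trivializationAt F A x) v

end Extension

section DualBundle

variable {E : Type*} [NormedAddCommGroup E] [NormedSpace ℝ E]
  {H : Type*} [TopologicalSpace H] {I : ModelWithCorners ℝ E H}
  {M : Type*} [TopologicalSpace M] [ChartedSpace H M]
  {F : Type*} [NormedAddCommGroup F] [NormedSpace ℝ F]
  {A : M → Type*} [TopologicalSpace (TotalSpace F A)]
  [∀ x, AddCommGroup (A x)] [∀ x, Module ℝ (A x)] [∀ x, TopologicalSpace (A x)]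
  [FiberBundle F A] [VectorBundle ℝ F A]

theorem contMDiff_linFun [IsManifold I ∞ M] [ContMDiffVectorBundle ∞ F A I] (μ : Sec I F A) :
    ContMDiff (I.prod 𝓘(ℝ, F →L[ℝ] ℝ)) 𝓘(ℝ, ℝ) ∞ (linFun μ) := by
  intro p
  have h1 : ContMDiffAt (I.prod 𝓘(ℝ, F →L[ℝ] ℝ)) (I.prod 𝓘(ℝ, F →L[ℝ] ℝ)) ∞
      (fun m : DualTotal F A => TotalSpace.mk' (F →L[ℝ] ℝ)
        (E := fun x => A x →L[ℝ] ℝ) m.proj m.2) p := contMDiffAt_id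
  have h2 : ContMDiffAt (I.prod 𝓘(ℝ, F →L[ℝ] ℝ)) (I.prod 𝓘(ℝ, F)) ∞
      (fun m : DualTotal F A => TotalSpace.mk' F m.proj (μ m.proj)) p :=
    μ.contMDiff.contMDiffAt.comp p (contMDiffAt_proj _)
  exact (contMDiffAt_totalSpace.1 (ContMDiffAt.clm_bundle_apply (F₂ := ℝ) (E₂ := fun _ : M => ℝ)
    (ϕ := fun m : DualTotal F A => m.2) h1 h2)).2

/-- The pull-back of a function on the base to the dual bundle. -/
def basicFun (F : Type*) [NormedAddCommGroup F] [NormedSpace ℝ F]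
    (A : M → Type*) [∀ x, AddCommGroup (A x)] [∀ x, Module ℝ (A x)] [∀ x, TopologicalSpace (A x)]
    (f : M → ℝ) : DualTotal F A → ℝ :=
  fun p => f p.proj

theorem contMDiff_basicFun [IsManifold I ∞ M] [ContMDiffVectorBundle ∞ F A I] {f : M → ℝ}
    (hf : ContMDiff I 𝓘(ℝ, ℝ) ∞ f) :
    ContMDiff (I.prod 𝓘(ℝ, F →L[ℝ] ℝ)) 𝓘(ℝ, ℝ) ∞ (basicFun F A f) :=
  hf.comp (contMDiff_proj _)

/-- The sum of a linear and a basic function. -/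
def affFun (μ : Sec I F A) (f : M → ℝ) : DualTotal F A → ℝ :=
  linFun μ + basicFun F A f

theorem contMDiff_affFun [IsManifold I ∞ M] [ContMDiffVectorBundle ∞ F A I] (μ : Sec I F A)
    {f : M → ℝ} (hf : ContMDiff I 𝓘(ℝ, ℝ) ∞ f) :
    ContMDiff (I.prod 𝓘(ℝ, F →L[ℝ] ℝ)) 𝓘(ℝ, ℝ) ∞ (affFun μ f) :=
  (contMDiff_linFun μ).add (contMDiff_basicFun hf)

theorem exists_eq_eval {F : Type*} [NormedAddCommGroup F] [NormedSpace ℝ F] [FiniteDimensional ℝ F]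
    (ξ : (F →L[ℝ] ℝ) →L[ℝ] ℝ) : ∃ v : F, ∀ b, ξ b = b v :=
  ⟨vectorOfBidual (I := 𝓘(ℝ, F)) (p := (0 : F)) ξ,
    fun b => (apply_vectorOfBidual (I := 𝓘(ℝ, F)) (p := (0 : F)) ξ b).symm⟩

variable [FiniteDimensional ℝ E] [FiniteDimensional ℝ F] [T2Space M] [IsManifold I ∞ M]
  [∀ x, IsTopologicalAddGroup (A x)] [∀ x, ContinuousSMul ℝ (A x)]
  [ContMDiffVectorBundle ∞ F A I]

/-- The linear coordinates on the dual bundle are fibrewise affine functions. -/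
theorem exists_affFun_eq_extChartAt (p₀ : DualTotal F A) (α : (E × (F →L[ℝ] ℝ)) →L[ℝ] ℝ) :
    ∃ (μ : Sec I F A) (f : C^∞⟮I, M; 𝓘(ℝ, ℝ), ℝ⟯), ∀ᶠ p in 𝓝 p₀,
      affFun μ f p = α (extChartAt (I.prod 𝓘(ℝ, F →L[ℝ] ℝ)) p₀ p) := by
  obtain ⟨f, hf⟩ := exists_contMDiffMap_eq_extChartAt (I := I) p₀.proj
    (α.comp (ContinuousLinearMap.inl ℝ E (F →L[ℝ] ℝ)))
  obtain ⟨v, hv⟩ := exists_eq_eval (α.comp (ContinuousLinearMap.inr ℝ E (F →L[ℝ] ℝ)))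
  obtain ⟨μ, hμ⟩ := exists_sec_trivialization I A p₀.proj v
  refine ⟨μ, f, ?_⟩
  have hc : Filter.Tendsto (TotalSpace.proj : DualTotal F A → M) (𝓝 p₀) (𝓝 p₀.proj) :=
    (FiberBundle.continuous_proj (F →L[ℝ] ℝ) (fun x => A x →L[ℝ] ℝ)).continuousAt
  filter_upwards [hc.eventually hf, hc.eventually hμ,
    hc.eventually ((trivializationAt F A p₀.proj).open_baseSet.mem_nhds
    (mem_baseSet_trivializationAt F A p₀.proj))] with p hfp hμp hp
  have hsplit : ∀ (a : E) (b : F →L[ℝ] ℝ), α (a, b) = α (a, 0) + b v := by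
    intro a b
    rw [← hv, ← sub_eq_iff_eq_add', ← map_sub]
    simp
  have hext : extChartAt (I.prod 𝓘(ℝ, F →L[ℝ] ℝ)) p₀ p = (extChartAt I p₀.proj p.proj,
      (trivializationAt (F →L[ℝ] ℝ) (fun x => A x →L[ℝ] ℝ) p₀.proj p).2) := by
    rw [FiberBundle.extChartAt]
    rfl
  rw [hext, hsplit, dual_trivialization_apply, ← hμp, add_comm]
  exact congrArg (linFun μ p + ·) hfp

theorem exists_affFun_mvfderiv_eventually (p₀ : DualTotal F A)
    (α : (E × (F →L[ℝ] ℝ)) →L[ℝ] ℝ) :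
    ∃ (μ : Sec I F A) (f : C^∞⟮I, M; 𝓘(ℝ, ℝ), ℝ⟯), ∀ᶠ p in 𝓝 p₀,
      mvfderiv (I.prod 𝓘(ℝ, F →L[ℝ] ℝ)) (affFun μ f) p =
        α.comp ((trivializationAt (E × (F →L[ℝ] ℝ))
          (TangentSpace (I.prod 𝓘(ℝ, F →L[ℝ] ℝ))) p₀).continuousLinearMapAt ℝ p) := by
  obtain ⟨μ, f, h⟩ := exists_affFun_eq_extChartAt (I := I) p₀ α
  refine ⟨μ, f, ?_⟩
  filter_upwards [eventually_eventually_nhds.2 h,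
    (chartAt (ModelProd H (F →L[ℝ] ℝ)) p₀).open_source.mem_nhds
    (mem_chart_source (ModelProd H (F →L[ℝ] ℝ)) p₀)] with p hp hps
  rw [mvfderiv_congr_of_eventuallyEq hp, mvfderiv_comp_extChartAt p₀ α hps]

/-- Every covector of the dual bundle is the differential of a fibrewise affine function. -/
theorem exists_affFun_mvfderiv (p : DualTotal F A) (α : Cotangent (I.prod 𝓘(ℝ, F →L[ℝ] ℝ)) p) :
    ∃ (μ : Sec I F A) (f : C^∞⟮I, M; 𝓘(ℝ, ℝ), ℝ⟯),
      mvfderiv (I.prod 𝓘(ℝ, F →L[ℝ] ℝ)) (affFun μ f) p = α := by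
  obtain ⟨μ, f, h⟩ := exists_affFun_mvfderiv_eventually (I := I) p
    (α.comp ((trivializationAt (E × (F →L[ℝ] ℝ))
      (TangentSpace (I.prod 𝓘(ℝ, F →L[ℝ] ℝ))) p).symmL ℝ p))
  refine ⟨μ, f, h.self_of_nhds.trans ?_⟩
  ext v
  exact congrArg α (Trivialization.symmL_continuousLinearMapAt _
    (mem_baseSet_trivializationAt _ _ p) v)

theorem contMDiff_vectorField_of_affFun
    {X : ∀ p : DualTotal F A, TangentSpace (I.prod 𝓘(ℝ, F →L[ℝ] ℝ)) p}
    (h : ∀ (μ : Sec I F A) (f : C^∞⟮I, M; 𝓘(ℝ, ℝ), ℝ⟯),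
      ContMDiff (I.prod 𝓘(ℝ, F →L[ℝ] ℝ)) 𝓘(ℝ, ℝ) ∞
        (fun p => mvfderiv (I.prod 𝓘(ℝ, F →L[ℝ] ℝ)) (affFun μ f) p (X p))) :
    ContMDiff (I.prod 𝓘(ℝ, F →L[ℝ] ℝ)) (I.prod 𝓘(ℝ, F →L[ℝ] ℝ)).tangent ∞
      (fun p => (⟨p, X p⟩ : TangentBundle (I.prod 𝓘(ℝ, F →L[ℝ] ℝ)) (DualTotal F A))) := by
  intro p₀
  refine contMDiffAt_tangentSection_of_apply fun α => ?_
  obtain ⟨μ, f, hμf⟩ := exists_affFun_mvfderiv_eventually (I := I) p₀ α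
  refine (h μ f p₀).congr_of_eventuallyEq ?_
  filter_upwards [hμf] with p hp
  rw [hp]
  rfl

/-- A field of alternating forms on the dual bundle is smooth when its values on the differentials
of fibrewise affine functions are smooth. -/
def BivectorField.ofAffFun
    (P : ∀ p : DualTotal F A, Cotangent (I.prod 𝓘(ℝ, F →L[ℝ] ℝ)) p →L[ℝ]
      Cotangent (I.prod 𝓘(ℝ, F →L[ℝ] ℝ)) p →L[ℝ] ℝ) (hP : ∀ p α, P p α α = 0)
    (h : ∀ (μ η : Sec I F A) (f g : C^∞⟮I, M; 𝓘(ℝ, ℝ), ℝ⟯),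
      ContMDiff (I.prod 𝓘(ℝ, F →L[ℝ] ℝ)) 𝓘(ℝ, ℝ) ∞
        (fun p => P p (mvfderiv (I.prod 𝓘(ℝ, F →L[ℝ] ℝ)) (affFun μ f) p)
          (mvfderiv (I.prod 𝓘(ℝ, F →L[ℝ] ℝ)) (affFun η g) p))) :
    BivectorField (I.prod 𝓘(ℝ, F →L[ℝ] ℝ)) (DualTotal F A) :=
  BivectorField.ofContMDiffAt P hP fun p₀ α β => by
    obtain ⟨μ, f, hμf⟩ := exists_affFun_mvfderiv_eventually (I := I) p₀ α
    obtain ⟨η, g, hηg⟩ := exists_affFun_mvfderiv_eventually (I := I) p₀ β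
    refine (h μ η f g p₀).congr_of_eventuallyEq ?_
    filter_upwards [hμf, hηg] with p hp hp'
    rw [hp, hp']

theorem BivectorField.ext_affFun
    {P Q : BivectorField (I.prod 𝓘(ℝ, F →L[ℝ] ℝ)) (DualTotal F A)}
    (h : ∀ (μ η : Sec I F A) (f g : C^∞⟮I, M; 𝓘(ℝ, ℝ), ℝ⟯),
      P.onDiff (affFun μ f) (affFun η g) = Q.onDiff (affFun μ f) (affFun η g)) : P = Q := by
  refine BivectorField.ext_apply fun p α β => ?_
  obtain ⟨μ, f, rfl⟩ := exists_affFun_mvfderiv (I := I) p α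
  obtain ⟨η, g, rfl⟩ := exists_affFun_mvfderiv (I := I) p β
  exact congrFun (h μ η f g) p

theorem vectorField_ext_affFun {p : DualTotal F A} {X Y : TangentSpace (I.prod 𝓘(ℝ, F →L[ℝ] ℝ)) p}
    (h : ∀ (μ : Sec I F A) (f : C^∞⟮I, M; 𝓘(ℝ, ℝ), ℝ⟯),
      mvfderiv (I.prod 𝓘(ℝ, F →L[ℝ] ℝ)) (affFun μ f) p X =
        mvfderiv (I.prod 𝓘(ℝ, F →L[ℝ] ℝ)) (affFun μ f) p Y) : X = Y := by
  refine tangent_ext fun α => ?_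
  obtain ⟨μ, f, rfl⟩ := exists_affFun_mvfderiv (I := I) p α
  exact h μ f

end DualBundle

/-! ### Tensorial operations on sections -/

section Tensor

variable {E : Type*} [NormedAddCommGroup E] [NormedSpace ℝ E] [FiniteDimensional ℝ E]
  {H : Type*} [TopologicalSpace H] {I : ModelWithCorners ℝ E H}
  {M : Type*} [TopologicalSpace M] [ChartedSpace H M] [T2Space M] [IsManifold I ∞ M]
  {F : Type*} [NormedAddCommGroup F] [NormedSpace ℝ F] [FiniteDimensional ℝ F]
  {A : M → Type*} [TopologicalSpace (TotalSpace F A)]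
  [∀ x, AddCommGroup (A x)] [∀ x, Module ℝ (A x)] [∀ x, TopologicalSpace (A x)]
  [FiberBundle F A] [VectorBundle ℝ F A]
  [ContMDiffVectorBundle ∞ F A I]

theorem frameSection_eventually (x : M) (i : Fin (finrank ℝ F)) :
    ∀ᶠ y in 𝓝 x, frameSection I F A x i y =
      (trivializationAt F A x).symmL ℝ y (finBasis ℝ F i) := by
  filter_upwards [(exists_frameSection I F A x i).choose_spec,
    (trivializationAt F A x).open_baseSet.mem_nhds (mem_baseSet_trivializationAt F A x)] with y hy hb
  rw [frameSection, hy, Trivialization.localFrame_apply_of_mem_baseSet _ _ hb,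
    Trivialization.symmL_apply _ hb]
  simp only [Trivialization.basisAt, Basis.map_apply]
  rfl

omit [T2Space M] in
theorem sum_coord_smul_symmL {x y : M} (hy : y ∈ (trivializationAt F A x).baseSet) (v : A y) :
    ∑ i, (finBasis ℝ F).coord i ((trivializationAt F A x).continuousLinearMapAt ℝ y v) •
      (trivializationAt F A x).symmL ℝ y (finBasis ℝ F i) = v := by
  simp only [← map_smul, ← map_sum, Basis.coord_apply, Basis.sum_repr]
  exact Trivialization.symmL_continuousLinearMapAt _ hy v

theorem sum_dualFrame_smul (x : M) (v : A x) :
    ∑ i, dualFrame F A x i v • frameSection I F A x i x = v := by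
  conv_rhs => rw [← sum_coord_smul_symmL (mem_baseSet_trivializationAt F A x) v]
  refine Finset.sum_congr rfl fun i _ => ?_
  rw [(frameSection_eventually (I := I) x i).self_of_nhds]
  rfl

theorem exists_coeff (x : M) (μ : Sec I F A) (i : Fin (finrank ℝ F)) :
    ∃ f : C^∞⟮I, M; 𝓘(ℝ, ℝ), ℝ⟯, ∀ᶠ y in 𝓝 x, f y =
      (finBasis ℝ F).coord i ((trivializationAt F A x).continuousLinearMapAt ℝ y (μ y)) := by
  refine exists_contMDiffMap_eventuallyEq (trivializationAt F A x).open_baseSet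
    (mem_baseSet_trivializationAt F A x) fun y hy => ContMDiffAt.contMDiffWithinAt ?_
  have h := ((trivializationAt F A x).contMDiffAt_section_iff hy).1 (μ.contMDiff y)
  have h' := (LinearMap.toContinuousLinearMap
    ((finBasis ℝ F).coord i)).contMDiff.contMDiffAt.comp y h
  refine h'.congr_of_eventuallyEq ?_
  filter_upwards [(trivializationAt F A x).open_baseSet.mem_nhds hy] with z hz
  simp [Trivialization.coe_linearMapAt_of_mem _ hz]

omit [FiniteDimensional ℝ F] [ContMDiffVectorBundle ∞ F A I] in
theorem Sec.tensor_eq_zero_of_eventually {V : Type*} [AddCommGroup V] [Module ℝ V]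
    (T : Sec I F A →+ V) {x : M}
    (hT : ∀ (f : C^∞⟮I, M; 𝓘(ℝ, ℝ), ℝ⟯) μ, T (Sec.funSMul f μ) = f x • T μ)
    {μ : Sec I F A} (hμ : ∀ᶠ y in 𝓝 x, μ y = 0) : T μ = 0 := by
  obtain ⟨f, hfx, hf⟩ := exists_bump_eq_zero I hμ
  have h0 : Sec.funSMul f μ = 0 := by
    ext y
    change f y • μ y = 0
    by_cases hy : μ y = 0
    · rw [hy, smul_zero]
    · rw [hf y hy, zero_smul]
  have h := hT f μ
  rw [h0, map_zero, hfx, one_smul] at h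
  exact h.symm

/-- An operation on sections that is linear over functions is determined by its values on a frame. -/
theorem Sec.tensor_eq_sum {V : Type*} [AddCommGroup V] [Module ℝ V]
    (T : Sec I F A →+ V) {x : M}
    (hT : ∀ (f : C^∞⟮I, M; 𝓘(ℝ, ℝ), ℝ⟯) μ, T (Sec.funSMul f μ) = f x • T μ) (μ : Sec I F A) :
    T μ = ∑ i, dualFrame F A x i (μ x) • T (frameSection I F A x i) := by
  choose c hc using exists_coeff (I := I) x μ
  have key : ∀ᶠ y in 𝓝 x,
      (μ - ∑ i, Sec.funSMul (c i) (frameSection I F A x i)) y = 0 := by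
    filter_upwards [Filter.eventually_all.2 hc,
      Filter.eventually_all.2 (frameSection_eventually (I := I) (F := F) (A := A) x),
      (trivializationAt F A x).open_baseSet.mem_nhds (mem_baseSet_trivializationAt F A x)]
      with y hcy hsy hy
    rw [ContMDiffSection.coe_sub, Pi.sub_apply, sub_eq_zero,
      ← ContMDiffSection.coeAddHom_apply (∑ i, _), map_sum, Finset.sum_apply]
    conv_lhs => rw [← sum_coord_smul_symmL hy (μ y)]
    refine Finset.sum_congr rfl fun i _ => ?_
    change _ = c i y • frameSection I F A x i y
    rw [hcy, hsy]
  have h := Sec.tensor_eq_zero_of_eventually T hT key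
  rw [map_sub, sub_eq_zero, map_sum] at h
  rw [h]
  refine Finset.sum_congr rfl fun i _ => ?_
  rw [hT, (hc i).self_of_nhds]
  rfl

end Tensor

/-! ### Vertical and horizontal vectors -/

section Lifts

variable {E : Type*} [NormedAddCommGroup E] [NormedSpace ℝ E]
  {H : Type*} [TopologicalSpace H] {I : ModelWithCorners ℝ E H}
  {E' : Type*} [NormedAddCommGroup E'] [NormedSpace ℝ E']
  {H' : Type*} [TopologicalSpace H'] {I' : ModelWithCorners ℝ E' H'}
  {M : Type*} [TopologicalSpace M] [ChartedSpace H M]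
  {N : Type*} [TopologicalSpace N] [ChartedSpace H' N]

theorem mvfderiv_mfderiv_of_eq {f : M → N} {g : N → ℝ} {x : M} {p : N} (hp : f x = p)
    (hg : MDifferentiableAt I' 𝓘(ℝ, ℝ) g p) (hf : MDifferentiableAt I I' f x)
    (v : TangentSpace I x) :
    mvfderiv I' g p (show TangentSpace I' p from mfderiv I I' f x v) = mvfderiv I (g ∘ f) x v := by
  subst hp
  exact (mvfderiv_comp_apply x hg hf v).symm

theorem mvfderiv_of_hasDerivAt {h : ℝ → ℝ} {h' t : ℝ} (hd : HasDerivAt h h' t) :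
    mvfderiv 𝓘(ℝ, ℝ) h t (1 : ℝ) = h' := by
  have e : mfderiv 𝓘(ℝ, ℝ) 𝓘(ℝ, ℝ) h t = (ContinuousLinearMap.toSpanSingleton ℝ h' : ℝ →L[ℝ] ℝ) :=
    hd.hasFDerivAt.hasMFDerivAt.mfderiv
  have e' : (mfderiv 𝓘(ℝ, ℝ) 𝓘(ℝ, ℝ) h t : ℝ →L[ℝ] ℝ) (1 : ℝ) =
      (ContinuousLinearMap.toSpanSingleton ℝ h' : ℝ →L[ℝ] ℝ) (1 : ℝ) :=
    congrArg (fun L : ℝ →L[ℝ] ℝ => L (1 : ℝ)) e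
  exact e'.trans ((ContinuousLinearMap.toSpanSingleton_apply ℝ h' (1 : ℝ)).trans (one_smul ℝ h'))

variable {F : Type*} [NormedAddCommGroup F] [NormedSpace ℝ F]
  {A : M → Type*} [TopologicalSpace (TotalSpace F A)]
  [∀ x, AddCommGroup (A x)] [∀ x, Module ℝ (A x)] [∀ x, TopologicalSpace (A x)]
  [FiberBundle F A] [VectorBundle ℝ F A]

section Vertical

variable [FiniteDimensional ℝ F]

theorem mdifferentiableAt_verticalCurve (p : DualTotal F A) (η : A p.proj →L[ℝ] ℝ) :
    MDifferentiableAt 𝓘(ℝ, ℝ) (I.prod 𝓘(ℝ, F →L[ℝ] ℝ))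
      (fun t : ℝ => (⟨p.proj, p.2 + t • η⟩ : DualTotal F A)) 0 := by
  refine ContMDiffAt.mdifferentiableAt (n := 1) ?_ (by simp)
  refine contMDiffAt_totalSpace.2 ⟨contMDiffAt_const, contMDiffAt_clm_of_apply fun v => ?_⟩
  simp only [dual_trivialization_apply]
  refine ContDiffAt.contMDiffAt ?_
  have h : ContDiff ℝ 1 fun t : ℝ => p.2 ((trivializationAt F A p.proj).symmL ℝ p.proj v) +
      t * η ((trivializationAt F A p.proj).symmL ℝ p.proj v) := by fun_prop
  exact h.contDiffAt

variable [IsManifold I ∞ M] [ContMDiffVectorBundle ∞ F A I]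

theorem mvfderiv_linFun_verticalVec (μ : Sec I F A) (p : DualTotal F A) (η : A p.proj →L[ℝ] ℝ) :
    mvfderiv (I.prod 𝓘(ℝ, F →L[ℝ] ℝ)) (linFun μ) p (verticalVec I p η) = η (μ p.proj) := by
  refine (mvfderiv_mfderiv_of_eq (by simp) ((contMDiff_linFun μ p).mdifferentiableAt (by simp))
    (mdifferentiableAt_verticalCurve p η) (1 : ℝ)).trans ?_
  have : (linFun μ ∘ fun t : ℝ => (⟨p.proj, p.2 + t • η⟩ : DualTotal F A)) =
      fun t => p.2 (μ p.proj) + t * η (μ p.proj) := by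
    funext t
    simp [linFun]
  rw [this]
  have hd : HasDerivAt (fun t : ℝ => p.2 (μ p.proj) + t * η (μ p.proj)) (η (μ p.proj)) 0 := by
    simpa using ((hasDerivAt_id (0 : ℝ)).mul_const (η (μ p.proj))).const_add (p.2 (μ p.proj))
  exact mvfderiv_of_hasDerivAt hd

theorem mvfderiv_basicFun_verticalVec {f : M → ℝ} (hf : ContMDiff I 𝓘(ℝ, ℝ) ∞ f)
    (p : DualTotal F A) (η : A p.proj →L[ℝ] ℝ) :
    mvfderiv (I.prod 𝓘(ℝ, F →L[ℝ] ℝ)) (basicFun F A f) p (verticalVec I p η) = 0 := by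
  refine (mvfderiv_mfderiv_of_eq (by simp)
    ((contMDiff_basicFun hf p).mdifferentiableAt (by simp))
    (mdifferentiableAt_verticalCurve p η) (1 : ℝ)).trans ?_
  have : (basicFun F A f ∘ fun t : ℝ => (⟨p.proj, p.2 + t • η⟩ : DualTotal F A)) =
      fun _ => f p.proj := rfl
  rw [this, mvfderiv_const]
  rfl

end Vertical

section Horizontal

variable [ContMDiffVectorBundle ∞ F A I]

/-- The local section of the dual bundle through `p` with constant fibre coordinates. -/
def horizontalSection (p : DualTotal F A) (y : M) : DualTotal F A :=
  (trivializationAt (F →L[ℝ] ℝ) (fun x => A x →L[ℝ] ℝ) p.proj).toOpenPartialHomeomorph.symm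
    (y, (trivializationAt (F →L[ℝ] ℝ) (fun x => A x →L[ℝ] ℝ) p.proj p).2)

theorem mdifferentiableAt_horizontalSection (p : DualTotal F A) :
    MDifferentiableAt I (I.prod 𝓘(ℝ, F →L[ℝ] ℝ)) (horizontalSection p) p.proj := by
  refine ContMDiffAt.mdifferentiableAt (n := ∞) ?_ (by simp)
  have hmem := mem_baseSet_trivializationAt (F →L[ℝ] ℝ) (fun x => A x →L[ℝ] ℝ) p.proj
  refine (contMDiffAt_trivSymmL (IB := I) (E₁ := fun x => A x →L[ℝ] ℝ) p.proj
    (trivializationAt (F →L[ℝ] ℝ) (fun x => A x →L[ℝ] ℝ) p.proj p).2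
    hmem).congr_of_eventuallyEq ?_
  filter_upwards [(trivializationAt (F →L[ℝ] ℝ) (fun x => A x →L[ℝ] ℝ)
    p.proj).open_baseSet.mem_nhds hmem] with y hy
  rw [Trivialization.symmL_apply _ hy, TotalSpace.mk', Trivialization.mk_symm _ hy]
  rfl

theorem horizontalSection_self (p : DualTotal F A) : horizontalSection p p.proj = p :=
  Trivialization.symm_apply_mk_proj _ FiberBundle.mem_trivializationAt_proj_source

variable [IsManifold I ∞ M]

theorem mvfderiv_basicFun_horizontalVec {f : M → ℝ} (hf : ContMDiff I 𝓘(ℝ, ℝ) ∞ f)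
    (p : DualTotal F A) (u : TangentSpace I p.proj) :
    mvfderiv (I.prod 𝓘(ℝ, F →L[ℝ] ℝ)) (basicFun F A f) p (horizontalVec I p u) =
      mvfderiv I f p.proj u := by
  refine (mvfderiv_mfderiv_of_eq (f := horizontalSection p)
    (horizontalSection_self p)
    ((contMDiff_basicFun hf p).mdifferentiableAt (by simp))
    (mdifferentiableAt_horizontalSection p) u).trans ?_
  refine congrArg (fun L => L u) (mvfderiv_congr_of_eventuallyEq ?_)
  have hmem := mem_baseSet_trivializationAt (F →L[ℝ] ℝ) (fun x => A x →L[ℝ] ℝ) p.proj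
  filter_upwards [(trivializationAt (F →L[ℝ] ℝ) (fun x => A x →L[ℝ] ℝ)
    p.proj).open_baseSet.mem_nhds hmem] with y hy
  exact congrArg f (Trivialization.proj_symm_apply' _ hy)

theorem mvfderiv_linFun_horizontalVec {μ : Sec I F A} {p : DualTotal F A} {v : F}
    (hμ : ∀ᶠ y in 𝓝 p.proj, μ y = (trivializationAt F A p.proj).symmL ℝ y v)
    (u : TangentSpace I p.proj) :
    mvfderiv (I.prod 𝓘(ℝ, F →L[ℝ] ℝ)) (linFun μ) p (horizontalVec I p u) = 0 := by
  refine (mvfderiv_mfderiv_of_eq (f := horizontalSection p)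
    (horizontalSection_self p)
    ((contMDiff_linFun μ p).mdifferentiableAt (by simp))
    (mdifferentiableAt_horizontalSection p) u).trans ?_
  refine (congrArg (fun L => L u) (mvfderiv_congr_of_eventuallyEq (g := fun _ =>
    (trivializationAt (F →L[ℝ] ℝ) (fun x => A x →L[ℝ] ℝ) p.proj p).2 v) ?_)).trans ?_
  · have hmem := mem_baseSet_trivializationAt (F →L[ℝ] ℝ) (fun x => A x →L[ℝ] ℝ) p.proj
    filter_upwards [hμ, (trivializationAt (F →L[ℝ] ℝ) (fun x => A x →L[ℝ] ℝ)
      p.proj).open_baseSet.mem_nhds hmem] with y hy hb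
    set c := (trivializationAt (F →L[ℝ] ℝ) (fun x => A x →L[ℝ] ℝ) p.proj p).2
    have hq := Trivialization.apply_symm_apply' (trivializationAt (F →L[ℝ] ℝ)
      (fun x => A x →L[ℝ] ℝ) p.proj) (x := c) hb
    have hproj := Trivialization.proj_symm_apply' (trivializationAt (F →L[ℝ] ℝ)
      (fun x => A x →L[ℝ] ℝ) p.proj) (x := c) hb
    set q : DualTotal F A := horizontalSection p y
    change q.2 (μ q.proj) = c v
    have h2 := dual_trivialization_apply p.proj q v
    change q.proj = y at hproj
    rw [← hproj] at hy
    rw [hy]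
    exact h2.symm.trans (congrArg (fun z => z.2 v) hq)
  · rw [mvfderiv_const]
    rfl

end Horizontal

end Lifts

/-! ### The linear Poisson bivector on differentials of linear and basic functions -/

section Evaluation

variable {E : Type*} [NormedAddCommGroup E] [NormedSpace ℝ E]
  {H : Type*} [TopologicalSpace H] {I : ModelWithCorners ℝ E H}
  {M : Type*} [TopologicalSpace M] [ChartedSpace H M]
  {F : Type*} [NormedAddCommGroup F] [NormedSpace ℝ F]
  {A : M → Type*} [TopologicalSpace (TotalSpace F A)]
  [∀ x, AddCommGroup (A x)] [∀ x, Module ℝ (A x)] [∀ x, TopologicalSpace (A x)]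
  [FiberBundle F A] [VectorBundle ℝ F A]

theorem linFun_add (μ η : Sec I F A) : linFun (μ + η) = linFun μ + linFun η := by
  funext p
  simp [linFun]

theorem linFun_sub (μ η : Sec I F A) : linFun (μ - η) = linFun μ - linFun η := by
  funext p
  simp [linFun]

theorem linFun_smul (c : ℝ) (μ : Sec I F A) : linFun (c • μ) = c • linFun μ := by
  funext p
  simp [linFun]

theorem linFun_zero : linFun (0 : Sec I F A) = 0 := by
  funext p
  simp [linFun]

theorem linFun_funSMul (f : C^∞⟮I, M; 𝓘(ℝ, ℝ), ℝ⟯) (μ : Sec I F A) :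
    linFun (Sec.funSMul f μ) = basicFun F A f * linFun μ := by
  funext p
  simp [linFun, Sec.funSMul, basicFun]

theorem linFun_injective : Function.Injective (linFun : Sec I F A → DualTotal F A → ℝ) := by
  intro μ η h
  ext x
  let e := (trivializationAt F A x).continuousLinearEquivAt ℝ x (mem_baseSet_trivializationAt F A x)
  refine e.injective ?_
  by_contra hne
  obtain ⟨α, hα⟩ := SeparatingDual.exists_ne_zero (R := ℝ) (sub_ne_zero.2 hne)
  refine hα ?_
  rw [map_sub, sub_eq_zero]
  exact congrFun h ⟨x, α.comp (e : A x →L[ℝ] F)⟩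

/-- The pairing of a section of the dual bundle with a section. -/
def DualSec.app [IsManifold I ∞ M] [∀ x, IsTopologicalAddGroup (A x)] [∀ x, ContinuousSMul ℝ (A x)]
    (φ : DualSec I F A) (μ : Sec I F A) : C^∞⟮I, M; 𝓘(ℝ, ℝ), ℝ⟯ where
  val x := φ x (μ x)
  property x := contMDiff_real_section_iff.1 ((φ.contMDiff x).clm_bundle_apply (μ.contMDiff x))

theorem LieAlgebroid.bracket_swap [IsManifold I ∞ M] (L : LieAlgebroid I F A) (μ η : Sec I F A) :
    L.bracket μ η = -L.bracket η μ := by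
  have h := L.bracket_self (μ + η)
  simp only [map_add, LinearMap.add_apply, L.bracket_self] at h
  rw [eq_neg_iff_add_eq_zero, ← h]
  abel

theorem LieAlgebroid.contMDiff_anchor [IsManifold I ∞ M] (L : LieAlgebroid I F A) (μ : Sec I F A) :
    ContMDiff I I.tangent ∞ (fun x => (⟨x, L.anchor x (μ x)⟩ : TangentBundle I M)) :=
  L.anchor_smooth.comp μ.contMDiff

/-- The derivative of a function on the base along the anchor of a section. -/
def LieAlgebroid.act [IsManifold I ∞ M] (L : LieAlgebroid I F A) (μ : Sec I F A)
    (f : C^∞⟮I, M; 𝓘(ℝ, ℝ), ℝ⟯) : C^∞⟮I, M; 𝓘(ℝ, ℝ), ℝ⟯ where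
  val x := mvfderiv I f x (L.anchor x (μ x))
  property x := contMDiffAt_mvfderiv_apply (f.contMDiff x) (L.contMDiff_anchor μ x)

omit [VectorBundle ℝ F A] in
theorem linFun_eq_affFun (μ : Sec I F A) :
    linFun μ = affFun μ (0 : C^∞⟮I, M; 𝓘(ℝ, ℝ), ℝ⟯) := by
  funext p
  exact (add_zero (linFun μ p)).symm

theorem basicFun_eq_affFun (f : C^∞⟮I, M; 𝓘(ℝ, ℝ), ℝ⟯) :
    basicFun F A f = affFun (0 : Sec I F A) f := by
  rw [affFun, linFun_zero, zero_add]

variable [IsManifold I ∞ M] [ContMDiffVectorBundle ∞ F A I]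

theorem mvfderiv_affFun (μ : Sec I F A) {f : M → ℝ} (hf : ContMDiff I 𝓘(ℝ, ℝ) ∞ f)
    (p : DualTotal F A) :
    mvfderiv (I.prod 𝓘(ℝ, F →L[ℝ] ℝ)) (affFun μ f) p =
      mvfderiv (I.prod 𝓘(ℝ, F →L[ℝ] ℝ)) (linFun μ) p +
        mvfderiv (I.prod 𝓘(ℝ, F →L[ℝ] ℝ)) (basicFun F A f) p :=
  mvfderiv_add_apply (contMDiff_linFun μ) (contMDiff_basicFun hf) p

theorem mvfderiv_linFun_add (μ η : Sec I F A) (p : DualTotal F A) :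
    mvfderiv (I.prod 𝓘(ℝ, F →L[ℝ] ℝ)) (linFun (μ + η)) p =
      mvfderiv (I.prod 𝓘(ℝ, F →L[ℝ] ℝ)) (linFun μ) p +
        mvfderiv (I.prod 𝓘(ℝ, F →L[ℝ] ℝ)) (linFun η) p := by
  rw [linFun_add, mvfderiv_add_apply (contMDiff_linFun μ) (contMDiff_linFun η)]

theorem mvfderiv_linFun_funSMul (f : C^∞⟮I, M; 𝓘(ℝ, ℝ), ℝ⟯) (μ : Sec I F A) (p : DualTotal F A) :
    mvfderiv (I.prod 𝓘(ℝ, F →L[ℝ] ℝ)) (linFun (Sec.funSMul f μ)) p =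
      f p.proj • mvfderiv (I.prod 𝓘(ℝ, F →L[ℝ] ℝ)) (linFun μ) p +
        p.2 (μ p.proj) • mvfderiv (I.prod 𝓘(ℝ, F →L[ℝ] ℝ)) (basicFun F A f) p := by
  rw [linFun_funSMul, mvfderiv_mul_apply (contMDiff_basicFun f.contMDiff) (contMDiff_linFun μ)]
  rfl

variable [FiniteDimensional ℝ E] [FiniteDimensional ℝ F] [T2Space M]

theorem LieAlgebroid.dualPoisson_apply (L : LieAlgebroid I F A) (p : DualTotal F A)
    (α β : Cotangent (I.prod 𝓘(ℝ, F →L[ℝ] ℝ)) p) :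
    L.dualPoisson p α β =
      (∑ i : Fin (finrank ℝ F), ∑ j ∈ Finset.Ioi i,
        p.2 (L.bracket (frameSection I F A p.proj i) (frameSection I F A p.proj j) p.proj) *
          (α (verticalVec I p (dualFrame F A p.proj i)) *
              β (verticalVec I p (dualFrame F A p.proj j)) -
            α (verticalVec I p (dualFrame F A p.proj j)) *
              β (verticalVec I p (dualFrame F A p.proj i)))) +
      ∑ i : Fin (finrank ℝ F),
        (α (verticalVec I p (dualFrame F A p.proj i)) *
            β (horizontalVec I p (L.anchor p.proj (frameSection I F A p.proj i p.proj))) -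
          α (horizontalVec I p (L.anchor p.proj (frameSection I F A p.proj i p.proj))) *
            β (verticalVec I p (dualFrame F A p.proj i))) := by
  simp only [LieAlgebroid.dualPoisson, add_apply, sum_apply,
    smul_apply, smul_eq_mul, wedgeVec_apply]

theorem LieAlgebroid.dualPoisson_self (L : LieAlgebroid I F A) (p : DualTotal F A)
    (α : Cotangent (I.prod 𝓘(ℝ, F →L[ℝ] ℝ)) p) : L.dualPoisson p α α = 0 := by
  rw [L.dualPoisson_apply, Finset.sum_eq_zero, Finset.sum_eq_zero, add_zero]
  · intro i _
    ring
  · intro i _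
    exact Finset.sum_eq_zero fun j _ => by ring

theorem LieAlgebroid.dualPoisson_swap (L : LieAlgebroid I F A) (p : DualTotal F A)
    (α β : Cotangent (I.prod 𝓘(ℝ, F →L[ℝ] ℝ)) p) :
    L.dualPoisson p α β = -L.dualPoisson p β α := by
  have h := L.dualPoisson_self p (α + β)
  simp only [map_add, add_apply, L.dualPoisson_self] at h
  linarith

theorem LieAlgebroid.dualPoisson_basicFun_basicFun (L : LieAlgebroid I F A) {f g : M → ℝ}
    (hf : ContMDiff I 𝓘(ℝ, ℝ) ∞ f) (hg : ContMDiff I 𝓘(ℝ, ℝ) ∞ g) (p : DualTotal F A) :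
    L.dualPoisson p (mvfderiv (I.prod 𝓘(ℝ, F →L[ℝ] ℝ)) (basicFun F A f) p)
      (mvfderiv (I.prod 𝓘(ℝ, F →L[ℝ] ℝ)) (basicFun F A g) p) = 0 := by
  rw [L.dualPoisson_apply]
  simp [mvfderiv_basicFun_verticalVec hf, mvfderiv_basicFun_verticalVec hg]

theorem LieAlgebroid.dualPoisson_linFun_basicFun (L : LieAlgebroid I F A) (μ : Sec I F A)
    {g : M → ℝ} (hg : ContMDiff I 𝓘(ℝ, ℝ) ∞ g) (p : DualTotal F A) :
    L.dualPoisson p (mvfderiv (I.prod 𝓘(ℝ, F →L[ℝ] ℝ)) (linFun μ) p)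
      (mvfderiv (I.prod 𝓘(ℝ, F →L[ℝ] ℝ)) (basicFun F A g) p) =
      mvfderiv I g p.proj (L.anchor p.proj (μ p.proj)) := by
  rw [L.dualPoisson_apply]
  simp only [mvfderiv_basicFun_verticalVec hg, mvfderiv_linFun_verticalVec,
    mvfderiv_basicFun_horizontalVec hg, mul_zero, sub_zero, Finset.sum_const_zero, zero_add]
  conv_rhs => rw [← sum_dualFrame_smul (I := I) (F := F) p.proj (μ p.proj)]
  simp only [map_sum, map_smul, smul_eq_mul]

theorem dualFrame_frameSection (x : M) (i j : Fin (finrank ℝ F)) :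
    dualFrame F A x i (frameSection I F A x j x) = if i = j then 1 else 0 := by
  rw [(frameSection_eventually (I := I) x j).self_of_nhds]
  simp only [dualFrame, ContinuousLinearMap.comp_apply]
  rw [Trivialization.continuousLinearMapAt_symmL _ (mem_baseSet_trivializationAt F A x)]
  simp [Finsupp.single_apply, eq_comm]

theorem LieAlgebroid.dualPoisson_linFun_linFun (L : LieAlgebroid I F A) (μ η : Sec I F A)
    (p : DualTotal F A) :
    L.dualPoisson p (mvfderiv (I.prod 𝓘(ℝ, F →L[ℝ] ℝ)) (linFun μ) p)
      (mvfderiv (I.prod 𝓘(ℝ, F →L[ℝ] ℝ)) (linFun η) p) = p.2 (L.bracket μ η p.proj) := by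
  let T (μ : Sec I F A) : Sec I F A →+ ℝ := AddMonoidHom.mk' (fun η =>
    L.dualPoisson p (mvfderiv (I.prod 𝓘(ℝ, F →L[ℝ] ℝ)) (linFun μ) p)
      (mvfderiv (I.prod 𝓘(ℝ, F →L[ℝ] ℝ)) (linFun η) p) - p.2 (L.bracket μ η p.proj)) (by
    intro η ζ
    simp only [mvfderiv_linFun_add, map_add, ContMDiffSection.coe_add, Pi.add_apply]
    ring)
  have hT (μ η : Sec I F A) : T μ η =
    L.dualPoisson p (mvfderiv (I.prod 𝓘(ℝ, F →L[ℝ] ℝ)) (linFun μ) p)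
      (mvfderiv (I.prod 𝓘(ℝ, F →L[ℝ] ℝ)) (linFun η) p) - p.2 (L.bracket μ η p.proj) := rfl
  have hswap (μ η : Sec I F A) : T μ η = -T η μ := by
    rw [hT, hT, L.dualPoisson_swap, L.bracket_swap]
    simp only [ContMDiffSection.coe_neg, Pi.neg_apply, map_neg]
    ring
  have hsmul (μ : Sec I F A) (f : C^∞⟮I, M; 𝓘(ℝ, ℝ), ℝ⟯) (η : Sec I F A) :
      T μ (Sec.funSMul f η) = f p.proj • T μ η := by
    simp only [hT, mvfderiv_linFun_funSMul, L.leibniz, map_add, map_smul, smul_eq_mul,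
      L.dualPoisson_linFun_basicFun μ f.contMDiff]
    ring
  have hframe (i j : Fin (finrank ℝ F)) :
      T (frameSection I F A p.proj i) (frameSection I F A p.proj j) = 0 := by
    rw [hT, L.dualPoisson_apply, sub_eq_zero]
    simp only [mvfderiv_linFun_verticalVec, dualFrame_frameSection,
      mvfderiv_linFun_horizontalVec (frameSection_eventually (I := I) (F := F) (A := A) p.proj _),
      mul_zero, zero_mul, sub_zero, Finset.sum_const_zero, add_zero]
    rcases lt_trichotomy i j with h | rfl | h
    · rw [Finset.sum_eq_single_of_mem i (Finset.mem_univ i),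
        Finset.sum_eq_single_of_mem j (Finset.mem_Ioi.2 h)]
      · simp [h.ne]
      · intro k _ hk
        simp [hk, h.ne]
      · intro k _ hk
        refine Finset.sum_eq_zero fun l hl => ?_
        have := Finset.mem_Ioi.1 hl
        have : ¬(l = i ∧ k = j) := by rintro ⟨rfl, rfl⟩; exact lt_asymm h this
        simp only [hk, if_false, zero_mul, zero_sub]
        rw [ite_zero_mul_ite_zero, if_neg this]
        simp
    · rw [L.bracket_self]
      refine (Finset.sum_eq_zero fun _ _ => Finset.sum_eq_zero fun _ _ => ?_).trans
        (map_zero p.2).symm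
      ring
    · rw [L.bracket_swap, Finset.sum_eq_single_of_mem j (Finset.mem_univ j),
        Finset.sum_eq_single_of_mem i (Finset.mem_Ioi.2 h)]
      · simp [h.ne]
      · intro k _ hk
        simp [hk, h.ne]
      · intro k _ hk
        refine Finset.sum_eq_zero fun l hl => ?_
        have := Finset.mem_Ioi.1 hl
        have : ¬(k = i ∧ l = j) := by rintro ⟨rfl, rfl⟩; exact lt_asymm h this
        simp only [hk, if_false, mul_zero, sub_zero]
        rw [ite_zero_mul_ite_zero, if_neg this]
        simp
  have h0 : T μ η = 0 := by
    rw [Sec.tensor_eq_sum (T μ) (hsmul μ)]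
    refine Finset.sum_eq_zero fun j _ => ?_
    rw [hswap, Sec.tensor_eq_sum _ (hsmul _), Finset.sum_eq_zero, neg_zero, smul_zero]
    intro i _
    rw [hframe, smul_zero]
  exact sub_eq_zero.1 h0

end Evaluation

/-! ### The Jacobi structure of a Lie algebroid with a cocycle -/

section Forward

variable {E : Type*} [NormedAddCommGroup E] [NormedSpace ℝ E]
  {H : Type*} [TopologicalSpace H] {I : ModelWithCorners ℝ E H}
  {M : Type*} [TopologicalSpace M] [ChartedSpace H M] [IsManifold I ∞ M]
  {F : Type*} [NormedAddCommGroup F] [NormedSpace ℝ F]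
  {A : M → Type*} [TopologicalSpace (TotalSpace F A)]
  [∀ x, AddCommGroup (A x)] [∀ x, Module ℝ (A x)] [∀ x, TopologicalSpace (A x)]
  [FiberBundle F A] [VectorBundle ℝ F A]

namespace LieAlgebroid

variable (L : LieAlgebroid I F A)

theorem act_sub (μ : Sec I F A) (f g : C^∞⟮I, M; 𝓘(ℝ, ℝ), ℝ⟯) :
    L.act μ (f - g) = L.act μ f - L.act μ g := by
  ext x
  change mvfderiv I (f - g : M → ℝ) x _ = mvfderiv I f x _ - mvfderiv I g x _
  rw [mvfderiv_sub_apply f.contMDiff g.contMDiff]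
  rfl

theorem act_neg (μ : Sec I F A) (f : C^∞⟮I, M; 𝓘(ℝ, ℝ), ℝ⟯) :
    L.act μ (-f) = -L.act μ f := by
  have h := L.act_sub μ 0 f
  have h0 := L.act_sub μ 0 0
  rw [sub_self, sub_self] at h0
  rwa [h0, zero_sub, zero_sub] at h

theorem sub_act (μ η : Sec I F A) (f : C^∞⟮I, M; 𝓘(ℝ, ℝ), ℝ⟯) :
    L.act (μ - η) f = L.act μ f - L.act η f := by
  ext x
  change mvfderiv I f x _ = mvfderiv I f x _ - mvfderiv I f x _
  simp

theorem add_act (μ η : Sec I F A) (f : C^∞⟮I, M; 𝓘(ℝ, ℝ), ℝ⟯) :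
    L.act (μ + η) f = L.act μ f + L.act η f := by
  ext x
  change mvfderiv I f x _ = mvfderiv I f x _ + mvfderiv I f x _
  simp

theorem funSMul_act (f : C^∞⟮I, M; 𝓘(ℝ, ℝ), ℝ⟯) (μ : Sec I F A) (g : C^∞⟮I, M; 𝓘(ℝ, ℝ), ℝ⟯) :
    L.act (Sec.funSMul f μ) g = f * L.act μ g := by
  ext x
  change mvfderiv I g x (L.anchor x (f x • μ x)) = f x * mvfderiv I g x _
  simp

theorem bracket_act [CompleteSpace E] (μ η : Sec I F A) (f : C^∞⟮I, M; 𝓘(ℝ, ℝ), ℝ⟯) :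
    L.act (L.bracket μ η) f = L.act μ (L.act η f) - L.act η (L.act μ f) := by
  ext x
  change mvfderiv I f x _ = mvfderiv I _ x _ - mvfderiv I _ x _
  rw [L.anchor_bracket]
  exact mvfderiv_mlieBracket (L.contMDiff_anchor μ) (L.contMDiff_anchor η) f.contMDiff x

theorem bracket_funSMul (f : C^∞⟮I, M; 𝓘(ℝ, ℝ), ℝ⟯) (μ η : Sec I F A) :
    L.bracket μ (Sec.funSMul f η) = Sec.funSMul f (L.bracket μ η) + Sec.funSMul (L.act μ f) η := by
  ext x
  exact L.leibniz f μ η x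

theorem funSMul_bracket (f : C^∞⟮I, M; 𝓘(ℝ, ℝ), ℝ⟯) (μ η : Sec I F A) :
    L.bracket (Sec.funSMul f μ) η = Sec.funSMul f (L.bracket μ η) - Sec.funSMul (L.act η f) μ := by
  rw [L.bracket_swap, L.bracket_funSMul, L.bracket_swap η μ]
  ext x
  change -(f x • (-(L.bracket μ η x)) + L.act η f x • μ x) =
    f x • L.bracket μ η x - L.act η f x • μ x
  module

end LieAlgebroid

variable [∀ x, IsTopologicalAddGroup (A x)] [∀ x, ContinuousSMul ℝ (A x)]

theorem DualSec.app_sub (φ : DualSec I F A) (μ η : Sec I F A) :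
    DualSec.app φ (μ - η) = DualSec.app φ μ - DualSec.app φ η := by
  ext x
  change φ x _ = φ x _ - φ x _
  simp

theorem DualSec.app_add (φ : DualSec I F A) (μ η : Sec I F A) :
    DualSec.app φ (μ + η) = DualSec.app φ μ + DualSec.app φ η := by
  ext x
  change φ x _ = φ x _ + φ x _
  simp

theorem DualSec.app_funSMul (φ : DualSec I F A) (f : C^∞⟮I, M; 𝓘(ℝ, ℝ), ℝ⟯) (μ : Sec I F A) :
    DualSec.app φ (Sec.funSMul f μ) = f * DualSec.app φ μ := by
  ext x
  change φ x (f x • μ x) = f x * φ x (μ x)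
  simp

namespace AlgebroidWithCocycle

variable (a : AlgebroidWithCocycle I F A)

theorem app_bracket (μ η : Sec I F A) :
    DualSec.app a.form (a.alg.bracket μ η) =
      a.alg.act μ (DualSec.app a.form η) - a.alg.act η (DualSec.app a.form μ) := by
  ext x
  exact a.cocycle μ η x

/-- The bracket `⟦μ, η⟧ + φ(η) μ - φ(μ) η`. -/
def twistedBracket (μ η : Sec I F A) : Sec I F A :=
  a.alg.bracket μ η + (Sec.funSMul (DualSec.app a.form η) μ - Sec.funSMul (DualSec.app a.form μ) η)

theorem app_twistedBracket (μ η : Sec I F A) :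
    DualSec.app a.form (a.twistedBracket μ η) = DualSec.app a.form (a.alg.bracket μ η) := by
  rw [twistedBracket, DualSec.app_add, DualSec.app_sub, DualSec.app_funSMul, DualSec.app_funSMul,
    mul_comm, sub_self, add_zero]

variable [ContMDiffVectorBundle ∞ F A I] [FiniteDimensional ℝ E] [FiniteDimensional ℝ F]
  [T2Space M]

theorem bivec_self (p : DualTotal F A) (α : Cotangent (I.prod 𝓘(ℝ, F →L[ℝ] ℝ)) p) :
    a.bivec p α α = 0 := by
  simp [AlgebroidWithCocycle.bivec, a.alg.dualPoisson_self, wedgeVec_apply, mul_comm]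

theorem bivec_affFun (μ η : Sec I F A) (f g : C^∞⟮I, M; 𝓘(ℝ, ℝ), ℝ⟯) (p : DualTotal F A) :
    a.bivec p (mvfderiv (I.prod 𝓘(ℝ, F →L[ℝ] ℝ)) (affFun μ f) p)
        (mvfderiv (I.prod 𝓘(ℝ, F →L[ℝ] ℝ)) (affFun η g) p) =
      affFun (a.twistedBracket μ η) (a.alg.act μ g - a.alg.act η f : C^∞⟮I, M; 𝓘(ℝ, ℝ), ℝ⟯) p := by
  simp only [mvfderiv_affFun _ f.contMDiff, mvfderiv_affFun _ g.contMDiff,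
    AlgebroidWithCocycle.bivec, map_add, add_apply,
    a.alg.dualPoisson_basicFun_basicFun f.contMDiff g.contMDiff,
    a.alg.dualPoisson_linFun_basicFun _ g.contMDiff,
    a.alg.dualPoisson_swap _ (mvfderiv _ (basicFun _ _ f) p) (mvfderiv _ (linFun _) p),
    a.alg.dualPoisson_linFun_basicFun _ f.contMDiff, a.alg.dualPoisson_linFun_linFun,
    wedgeVec_apply, liouville, verticalLift, mvfderiv_linFun_verticalVec,
    mvfderiv_basicFun_verticalVec f.contMDiff, mvfderiv_basicFun_verticalVec g.contMDiff]
  simp only [affFun, twistedBracket, linFun_add, linFun_sub, linFun_funSMul, Pi.add_apply,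
    Pi.sub_apply, Pi.mul_apply]
  change _ = p.2 (a.alg.bracket μ η p.proj) + (a.form p.proj (η p.proj) * p.2 (μ p.proj) -
    a.form p.proj (μ p.proj) * p.2 (η p.proj)) + (mvfderiv I g p.proj (a.alg.anchor p.proj (μ p.proj))
      - mvfderiv I f p.proj (a.alg.anchor p.proj (η p.proj)))
  ring

omit [FiniteDimensional ℝ E] [T2Space M] in
theorem mvfderiv_affFun_vec (μ : Sec I F A) (f : C^∞⟮I, M; 𝓘(ℝ, ℝ), ℝ⟯) (p : DualTotal F A) :
    mvfderiv (I.prod 𝓘(ℝ, F →L[ℝ] ℝ)) (affFun μ f) p (a.vec p) =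
      affFun (0 : Sec I F A) (-DualSec.app a.form μ : C^∞⟮I, M; 𝓘(ℝ, ℝ), ℝ⟯) p := by
  simp only [mvfderiv_affFun _ f.contMDiff, AlgebroidWithCocycle.vec, verticalLift, map_neg,
    add_apply, mvfderiv_linFun_verticalVec, mvfderiv_basicFun_verticalVec f.contMDiff]
  simp only [affFun, linFun_zero, zero_add, add_zero]
  rfl

/-- The bivector field `Λ_{(A*, φ)}`. -/
def bivectorField : BivectorField (I.prod 𝓘(ℝ, F →L[ℝ] ℝ)) (DualTotal F A) :=
  BivectorField.ofAffFun a.bivec a.bivec_self fun μ η f g => by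
    simp only [bivec_affFun]
    exact contMDiff_affFun _ (ContMDiffMap.contMDiff _)

/-- The vector field `E_{(A*, φ)}`. -/
def vectorField : SmoothVectorField (I.prod 𝓘(ℝ, F →L[ℝ] ℝ)) (DualTotal F A) where
  toFun := a.vec
  contMDiff_toFun := contMDiff_vectorField_of_affFun fun μ f => by
    simp only [mvfderiv_affFun_vec]
    exact contMDiff_affFun _ (ContMDiffMap.contMDiff _)

theorem bivectorField_onDiff (μ η : Sec I F A) (f g : C^∞⟮I, M; 𝓘(ℝ, ℝ), ℝ⟯) :
    a.bivectorField.onDiff (affFun μ f) (affFun η g) =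
      affFun (a.twistedBracket μ η) (a.alg.act μ g - a.alg.act η f : C^∞⟮I, M; 𝓘(ℝ, ℝ), ℝ⟯) :=
  funext fun p => a.bivec_affFun μ η f g p

theorem vectorField_deriv (μ : Sec I F A) (f : C^∞⟮I, M; 𝓘(ℝ, ℝ), ℝ⟯) :
    a.vectorField.deriv (affFun μ f) =
      affFun (0 : Sec I F A) (-DualSec.app a.form μ : C^∞⟮I, M; 𝓘(ℝ, ℝ), ℝ⟯) :=
  funext fun p => a.mvfderiv_affFun_vec μ f p

theorem schoutenVector_affFun (μ η : Sec I F A) (f g : C^∞⟮I, M; 𝓘(ℝ, ℝ), ℝ⟯) :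
    schoutenVector a.vectorField a.bivectorField (affFun μ f) (affFun η g) = 0 := by
  rw [schoutenVector, a.bivectorField_onDiff, a.vectorField_deriv, a.vectorField_deriv,
    a.vectorField_deriv, a.bivectorField_onDiff, a.bivectorField_onDiff, a.app_twistedBracket,
    a.app_bracket, a.alg.act_neg, a.alg.act_neg]
  funext p
  simp only [affFun, twistedBracket, linFun_add, linFun_sub, linFun_funSMul, linFun_zero,
    Pi.add_apply, Pi.sub_apply, Pi.mul_apply, Pi.zero_apply]
  have h0 : ∀ (h : C^∞⟮I, M; 𝓘(ℝ, ℝ), ℝ⟯), a.alg.act 0 h p.proj = 0 := by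
    intro h
    change mvfderiv I h _ (a.alg.anchor _ (0 : A p.proj)) = 0
    simp
  have h1 : linFun (a.alg.bracket 0 η) p = 0 := by simp [linFun]
  have h2 : linFun (a.alg.bracket μ 0) p = 0 := by simp [linFun]
  have h3 : a.form.app (0 : Sec I F A) p.proj = 0 := (a.form p.proj).map_zero
  simp only [h1, h2, basicFun]
  change 0 + -(a.alg.act μ (a.form.app η) p.proj - a.alg.act η (a.form.app μ) p.proj) -
    (0 + (a.form.app η p.proj * 0 - a.form.app 0 p.proj * linFun η p) +
      (a.alg.act 0 g p.proj - -a.alg.act η (a.form.app μ) p.proj)) -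
    (0 + (a.form.app 0 p.proj * linFun μ p - a.form.app μ p.proj * 0) +
      (-a.alg.act μ (a.form.app η) p.proj - a.alg.act 0 f p.proj)) = 0
  rw [h3]
  rw [h0, h0]
  ring

theorem schoutenBivector_affFun (μ η ζ : Sec I F A) (f g h : C^∞⟮I, M; 𝓘(ℝ, ℝ), ℝ⟯) :
    schoutenBivector a.bivectorField a.bivectorField (affFun μ f) (affFun η g) (affFun ζ h) =
      2 * wedgeVectorBivector a.vectorField a.bivectorField
        (affFun μ f) (affFun η g) (affFun ζ h) := by
  have : CompleteSpace E := FiniteDimensional.complete ℝ E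
  simp only [schoutenBivector, wedgeVectorBivector, bivectorField_onDiff, vectorField_deriv]
  funext p
  have key (μ η ζ : Sec I F A) (f g h : C^∞⟮I, M; 𝓘(ℝ, ℝ), ℝ⟯) :
      affFun (a.twistedBracket (a.twistedBracket μ η) ζ)
        (a.alg.act (a.twistedBracket μ η) h - a.alg.act ζ (a.alg.act μ g - a.alg.act η f) :
          C^∞⟮I, M; 𝓘(ℝ, ℝ), ℝ⟯) p =
        - linFun (a.alg.bracket ζ (a.alg.bracket μ η)) p
        + a.form.app η p.proj * linFun (a.alg.bracket μ ζ) p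
        - a.alg.act ζ (a.form.app η) p.proj * linFun μ p
        - a.form.app μ p.proj * linFun (a.alg.bracket η ζ) p
        + a.alg.act ζ (a.form.app μ) p.proj * linFun η p
        + a.form.app ζ p.proj * (linFun (a.alg.bracket μ η) p
          + (a.form.app η p.proj * linFun μ p - a.form.app μ p.proj * linFun η p))
        - (a.alg.act μ (a.form.app η) p.proj - a.alg.act η (a.form.app μ) p.proj) * linFun ζ p
        + (a.alg.act μ (a.alg.act η h) p.proj - a.alg.act η (a.alg.act μ h) p.proj
          + (a.form.app η p.proj * a.alg.act μ h p.proj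
            - a.form.app μ p.proj * a.alg.act η h p.proj)
          - (a.alg.act ζ (a.alg.act μ g) p.proj - a.alg.act ζ (a.alg.act η f) p.proj)) := by
    conv_lhs => rw [affFun, Pi.add_apply, twistedBracket, a.app_twistedBracket, a.app_bracket]
    simp only [twistedBracket, map_add, map_sub, LinearMap.add_apply, LinearMap.sub_apply,
      a.alg.funSMul_bracket, a.alg.add_act, a.alg.sub_act, a.alg.funSMul_act, a.alg.bracket_act,
      a.alg.act_sub, linFun_add, linFun_sub, linFun_funSMul, Pi.add_apply, Pi.sub_apply,
      Pi.mul_apply]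
    have hs : linFun (a.alg.bracket (a.alg.bracket μ η) ζ) p =
        -linFun (a.alg.bracket ζ (a.alg.bracket μ η)) p := by
      rw [a.alg.bracket_swap]
      simp [linFun]
    rw [hs]
    simp only [basicFun, ContMDiffMap.coe_add, ContMDiffMap.coe_sub, ContMDiffMap.coe_mul,
      Pi.add_apply, Pi.sub_apply, Pi.mul_apply]
    ring
  have hw (μ η ζ : Sec I F A) (f g h : C^∞⟮I, M; 𝓘(ℝ, ℝ), ℝ⟯) :
      affFun (0 : Sec I F A) (-a.form.app μ : C^∞⟮I, M; 𝓘(ℝ, ℝ), ℝ⟯) p *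
        affFun (a.twistedBracket η ζ) (a.alg.act η h - a.alg.act ζ g : C^∞⟮I, M; 𝓘(ℝ, ℝ), ℝ⟯) p =
      -a.form.app μ p.proj * (linFun (a.alg.bracket η ζ) p + (a.form.app ζ p.proj * linFun η p
        - a.form.app η p.proj * linFun ζ p) + (a.alg.act η h p.proj - a.alg.act ζ g p.proj)) := by
    simp only [affFun, twistedBracket, linFun_zero, linFun_add, linFun_sub,
      linFun_funSMul, Pi.add_apply, Pi.sub_apply, Pi.mul_apply, Pi.zero_apply, zero_add]
    rfl
  simp only [Pi.add_apply, Pi.mul_apply, key, hw μ η ζ f g h, hw η ζ μ g h f, hw ζ μ η h f g,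
    Pi.ofNat_apply]
  have j := congrArg (fun ν => linFun ν p) (a.alg.jacobi μ η ζ)
  have s (μ η : Sec I F A) : linFun (a.alg.bracket μ η) p = -linFun (a.alg.bracket η μ) p := by
    rw [a.alg.bracket_swap]
    simp [linFun]
  simp only [linFun_add, linFun_zero, Pi.add_apply, Pi.zero_apply] at j
  rw [s μ ζ, s ζ η, s η μ]
  linear_combination (-2) * j

/-- The Jacobi structure `(Λ_{(A*, φ)}, E_{(A*, φ)})`. -/
def jacobiStructure : JacobiStructure (I.prod 𝓘(ℝ, F →L[ℝ] ℝ)) (DualTotal F A) where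
  Lam := a.bivectorField
  vec := a.vectorField
  schouten_self f g h hf hg hh := by
    funext p
    obtain ⟨μ, f', ef⟩ := exists_affFun_mvfderiv (I := I) p (mvfderiv _ f p)
    obtain ⟨η, g', eg⟩ := exists_affFun_mvfderiv (I := I) p (mvfderiv _ g p)
    obtain ⟨ζ, h', eh⟩ := exists_affFun_mvfderiv (I := I) p (mvfderiv _ h p)
    rw [← schoutenBivector_congr a.bivectorField (contMDiff_affFun μ f'.contMDiff) hf
      (contMDiff_affFun η g'.contMDiff) hg (contMDiff_affFun ζ h'.contMDiff) hh ef eg eh,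
      schoutenBivector_affFun]
    simp only [Pi.mul_apply, wedgeVectorBivector, Pi.add_apply, SmoothVectorField.deriv,
      BivectorField.onDiff, ef, eg, eh]
  schouten_vec f g hf hg := by
    funext p
    obtain ⟨μ, f', ef⟩ := exists_affFun_mvfderiv (I := I) p (mvfderiv _ f p)
    obtain ⟨η, g', eg⟩ := exists_affFun_mvfderiv (I := I) p (mvfderiv _ g p)
    rw [← schoutenVector_congr a.vectorField a.bivectorField (contMDiff_affFun μ f'.contMDiff) hf
      (contMDiff_affFun η g'.contMDiff) hg ef eg, schoutenVector_affFun]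

theorem bivectorField_onDiff_linFun (μ η : Sec I F A) :
    a.bivectorField.onDiff (linFun μ) (linFun η) = linFun (a.twistedBracket μ η) := by
  rw [linFun_eq_affFun μ, linFun_eq_affFun η, bivectorField_onDiff,
    ← sub_self (0 : C^∞⟮I, M; 𝓘(ℝ, ℝ), ℝ⟯),
    a.alg.act_sub, a.alg.act_sub, sub_self, sub_self, sub_self, linFun_eq_affFun]

theorem bivectorField_onDiff_linFun_basicFun (μ : Sec I F A) (f : C^∞⟮I, M; 𝓘(ℝ, ℝ), ℝ⟯) :
    a.bivectorField.onDiff (linFun μ) (basicFun F A f) = basicFun F A (a.alg.act μ f) := by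
  have h : a.twistedBracket μ 0 = 0 := by
    ext x
    change a.alg.bracket μ 0 x + (a.form x (0 : A x) • μ x - a.form x (μ x) • (0 : A x)) = 0
    simp
  rw [linFun_eq_affFun, basicFun_eq_affFun, bivectorField_onDiff, h, basicFun_eq_affFun,
    ← sub_self (0 : C^∞⟮I, M; 𝓘(ℝ, ℝ), ℝ⟯), a.alg.act_sub, sub_self, sub_zero]

theorem vectorField_deriv_linFun (μ : Sec I F A) :
    a.vectorField.deriv (linFun μ) = basicFun F A (-a.form.app μ : C^∞⟮I, M; 𝓘(ℝ, ℝ), ℝ⟯) := by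
  rw [linFun_eq_affFun, vectorField_deriv, basicFun_eq_affFun]

theorem jacobiStructure_bracket_linFun (μ η : Sec I F A) :
    a.jacobiStructure.bracket (linFun μ) (linFun η) = linFun (a.alg.bracket μ η) := by
  simp only [JacobiStructure.bracket, jacobiStructure, bivectorField_onDiff_linFun,
    vectorField_deriv_linFun]
  funext p
  simp only [twistedBracket, linFun_add, linFun_sub, linFun_funSMul, Pi.add_apply, Pi.sub_apply,
    Pi.mul_apply]
  change _ + (a.form.app η p.proj * _ - a.form.app μ p.proj * _) + _ * (-a.form.app η p.proj)
    - _ * (-a.form.app μ p.proj) = _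
  ring

theorem jacobiStructure_bracket_one (μ : Sec I F A) :
    a.jacobiStructure.bracket (linFun μ) 1 = basicFun F A (a.form.app μ) := by
  funext p
  have h : mvfderiv (I.prod 𝓘(ℝ, F →L[ℝ] ℝ)) (1 : DualTotal F A → ℝ) p = 0 :=
    mvfderiv_const 1
  simp only [JacobiStructure.bracket, jacobiStructure, vectorField_deriv_linFun, Pi.add_apply,
    Pi.sub_apply, Pi.mul_apply, Pi.one_apply, BivectorField.onDiff, SmoothVectorField.deriv, h]
  change _ + _ - 1 * (-a.form.app μ p.proj) = a.form.app μ p.proj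
  simp

theorem jacobiStructure_mem_linearJacobi : a.jacobiStructure ∈ linearJacobi I F A := by
  constructor
  · rintro _ _ ⟨μ, rfl⟩ ⟨η, rfl⟩
    exact ⟨_, a.jacobiStructure_bracket_linFun μ η⟩
  · rintro _ ⟨μ, rfl⟩
    exact ⟨_, a.jacobiStructure_bracket_one μ⟩

theorem jacobiStructure_injective :
    Function.Injective fun a : AlgebroidWithCocycle I F A => a.jacobiStructure := by
  intro a b hab
  change a.jacobiStructure = b.jacobiStructure at hab
  have hL' : a.jacobiStructure.Lam = b.jacobiStructure.Lam := by rw [hab]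
  have hL : a.bivectorField = b.bivectorField := hL'
  have hform : a.form = b.form := by
    ext x v
    obtain ⟨μ, rfl⟩ := exists_sec_apply_eq I F x v
    have h := a.jacobiStructure_bracket_one μ
    rw [hab, b.jacobiStructure_bracket_one μ] at h
    exact (congrFun h ⟨x, 0⟩).symm
  have hbr : a.alg.bracket = b.alg.bracket := by
    refine LinearMap.ext fun μ => LinearMap.ext fun η => linFun_injective ?_
    rw [← a.jacobiStructure_bracket_linFun, hab, b.jacobiStructure_bracket_linFun]
  have hanchor : a.alg.anchor = b.alg.anchor := by
    funext x
    ext v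
    obtain ⟨μ, rfl⟩ := exists_sec_apply_eq I F x v
    refine tangent_ext fun α => ?_
    obtain ⟨f, rfl⟩ := exists_contMDiffMap_mvfderiv_eq x α
    have h := a.bivectorField_onDiff_linFun_basicFun μ f
    rw [hL, b.bivectorField_onDiff_linFun_basicFun] at h
    exact (congrFun h ⟨x, 0⟩).symm
  rcases a with ⟨⟨_, _, _, _, _, _, _⟩, _, _⟩
  rcases b with ⟨⟨_, _, _, _, _, _, _⟩, _, _⟩
  subst hform hbr hanchor
  rfl

end AlgebroidWithCocycle

end Forward

/-! ### Linear Jacobi structures -/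

section Backward

variable {E : Type*} [NormedAddCommGroup E] [NormedSpace ℝ E]
  {H : Type*} [TopologicalSpace H] {I : ModelWithCorners ℝ E H}
  {M : Type*} [TopologicalSpace M] [ChartedSpace H M] [IsManifold I ∞ M]
  {F : Type*} [NormedAddCommGroup F] [NormedSpace ℝ F] [FiniteDimensional ℝ F]
  {A : M → Type*} [TopologicalSpace (TotalSpace F A)]
  [∀ x, AddCommGroup (A x)] [∀ x, Module ℝ (A x)] [∀ x, TopologicalSpace (A x)]
  [FiberBundle F A] [VectorBundle ℝ F A]

section Zero

omit [IsManifold I ∞ M] in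
theorem eq_of_forall_smul_eq (I : ModelWithCorners ℝ E H) {h : DualTotal F A → ℝ}
    (hh : Continuous h) {x : M}
    {η : A x →L[ℝ] ℝ} {a : ℝ} (ha : ∀ c : ℝ, c ≠ 0 → h ⟨x, c • η⟩ = a) : h ⟨x, 0⟩ = a := by
  have h1 : ContinuousAt (fun t : ℝ => (⟨x, (0 : A x →L[ℝ] ℝ) + t • η⟩ : DualTotal F A)) 0 :=
    (mdifferentiableAt_verticalCurve (I := I) (⟨x, 0⟩ : DualTotal F A) η).continuousAt
  have h2 := (hh.continuousAt.comp h1).tendsto.mono_left (nhdsWithin_le_nhds (s := {0}ᶜ))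
  refine tendsto_nhds_unique (f := fun _ : ℝ => a) (l := 𝓝[≠] 0) ?_ tendsto_const_nhds
  have h3 : h ⟨x, 0⟩ = (h ∘ fun t : ℝ => (⟨x, (0 : A x →L[ℝ] ℝ) + t • η⟩ : DualTotal F A)) 0 := by
    simp
  rw [h3]
  refine h2.congr' ?_
  filter_upwards [self_mem_nhdsWithin] with c hc
  simpa using ha c hc

variable [FiniteDimensional ℝ E] [T2Space M] [∀ x, IsTopologicalAddGroup (A x)]
  [∀ x, ContinuousSMul ℝ (A x)] [ContMDiffVectorBundle ∞ F A I]

omit [FiniteDimensional ℝ F] in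
variable (I) in
theorem exists_linFun_ne_zero {p : DualTotal F A} (hp : p.2 ≠ 0) :
    ∃ μ : Sec I F A, linFun μ p ≠ 0 := by
  obtain ⟨v, hv⟩ := DFunLike.ne_iff.1 hp
  obtain ⟨μ, rfl⟩ := exists_sec_apply_eq I F p.proj v
  exact ⟨μ, hv⟩

/-- A continuous function whose product with every linear function is linear is constant on the
fibres. -/
theorem eq_comp_zero_of_linFun_mul {h : DualTotal F A → ℝ} (hh : Continuous h)
    (H : ∀ μ : Sec I F A, IsLinearFun I F A (linFun μ * h)) (p : DualTotal F A) :
    h p = h ⟨p.proj, 0⟩ := by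
  by_cases hp : p.2 = 0
  · rw [← hp]
  obtain ⟨μ, hμ⟩ := exists_linFun_ne_zero I hp
  refine (eq_of_forall_smul_eq I hh (η := p.2) fun c hc => ?_).symm
  obtain ⟨ν, hν⟩ := H μ
  have h1 := congrFun hν p
  have h2 := congrFun hν ⟨p.proj, c • p.2⟩
  simp only [Pi.mul_apply, linFun, smul_apply, smul_eq_mul] at h1 h2
  rw [← h1] at h2
  have h3 : c * p.2 (μ p.proj) ≠ 0 := mul_ne_zero hc hμ
  refine mul_left_cancel₀ h3 ?_
  rw [h2]
  ring

/-- A continuous function whose product with every linear function is basic vanishes. -/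
theorem eq_zero_of_linFun_mul [Nontrivial F] {h : DualTotal F A → ℝ} (hh : Continuous h)
    (H : ∀ μ : Sec I F A, IsBasicFun I F A (linFun μ * h)) : h = 0 := by
  have key : ∀ p : DualTotal F A, p.2 ≠ 0 → h p = 0 := by
    intro p hp
    obtain ⟨μ, hμ⟩ := exists_linFun_ne_zero I hp
    obtain ⟨f, hf⟩ := H μ
    have h1 := congrFun hf p
    have h2 := congrFun hf ⟨p.proj, 0⟩
    simp only [Pi.mul_apply, linFun, zero_apply, zero_mul] at h1 h2
    rw [← h2] at h1
    exact (mul_eq_zero.1 h1).resolve_left hμ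
  funext p
  by_cases hp : p.2 = 0
  · let e := (trivializationAt F A p.proj).continuousLinearEquivAt ℝ p.proj
      (mem_baseSet_trivializationAt F A p.proj)
    obtain ⟨v, hv⟩ := exists_ne (0 : F)
    obtain ⟨α, hα⟩ := SeparatingDual.exists_ne_zero (R := ℝ) hv
    have hη : α.comp (e : A p.proj →L[ℝ] F) ≠ 0 := fun h0 => hα (by
      simpa using congrArg (fun L : A p.proj →L[ℝ] ℝ => L (e.symm v)) h0)
    have := eq_of_forall_smul_eq I hh (η := α.comp (e : A p.proj →L[ℝ] F)) (a := 0)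
      fun c hc => key _ (smul_ne_zero hc hη)
    rw [← hp] at this
    exact this
  · exact key p hp

end Zero

variable [FiniteDimensional ℝ E] [T2Space M] [∀ x, IsTopologicalAddGroup (A x)]
  [∀ x, ContinuousSMul ℝ (A x)] [ContMDiffVectorBundle ∞ F A I]

/-- The operations on sections that describe a linear Jacobi structure. -/
structure LinearJacobiData (J : JacobiStructure (I.prod 𝓘(ℝ, F →L[ℝ] ℝ)) (DualTotal F A)) where
  /-- the bracket of sections -/
  bracket : Sec I F A → Sec I F A → Sec I F A
  /-- the 1-form, as an operation on sections -/
  form : Sec I F A → C^∞⟮I, M; 𝓘(ℝ, ℝ), ℝ⟯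
  /-- the anchor, as an operation of sections on functions -/
  act : Sec I F A → C^∞⟮I, M; 𝓘(ℝ, ℝ), ℝ⟯ → C^∞⟮I, M; 𝓘(ℝ, ℝ), ℝ⟯
  linFun_bracket : ∀ μ η, J.bracket (linFun μ) (linFun η) = linFun (bracket μ η)
  deriv_linFun : ∀ μ, J.vec.deriv (linFun μ) = -basicFun F A (form μ)
  onDiff_linFun_basicFun : ∀ (μ : Sec I F A) (f : C^∞⟮I, M; 𝓘(ℝ, ℝ), ℝ⟯),
    J.Lam.onDiff (linFun μ) (basicFun F A f) = basicFun F A (act μ f)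
  deriv_basicFun : ∀ f : C^∞⟮I, M; 𝓘(ℝ, ℝ), ℝ⟯, J.vec.deriv (basicFun F A f) = 0
  onDiff_basicFun : ∀ f g : C^∞⟮I, M; 𝓘(ℝ, ℝ), ℝ⟯,
    J.Lam.onDiff (basicFun F A f) (basicFun F A g) = 0

omit [T2Space M] [FiniteDimensional ℝ E] [FiniteDimensional ℝ F]
  [∀ x, IsTopologicalAddGroup (A x)] [∀ x, ContinuousSMul ℝ (A x)] in
theorem JacobiStructure.bracket_one
    (J : JacobiStructure (I.prod 𝓘(ℝ, F →L[ℝ] ℝ)) (DualTotal F A)) (f : DualTotal F A → ℝ) :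
    J.bracket f 1 = -J.vec.deriv f := by
  funext p
  have h : mvfderiv (I.prod 𝓘(ℝ, F →L[ℝ] ℝ)) (1 : DualTotal F A → ℝ) p = 0 :=
    mvfderiv_const 1
  simp [JacobiStructure.bracket, BivectorField.onDiff, SmoothVectorField.deriv, h]

theorem nonempty_linearJacobiData [Nontrivial F]
    {J : JacobiStructure (I.prod 𝓘(ℝ, F →L[ℝ] ℝ)) (DualTotal F A)}
    (hJ : J ∈ linearJacobi I F A) : Nonempty (LinearJacobiData J) := by
  have hlin (μ : Sec I F A) := contMDiff_linFun μ
  have hbas (f : C^∞⟮I, M; 𝓘(ℝ, ℝ), ℝ⟯) : ContMDiff (I.prod 𝓘(ℝ, F →L[ℝ] ℝ)) 𝓘(ℝ, ℝ) ∞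
    (basicFun F A f) := contMDiff_basicFun f.contMDiff
  have hb (μ η : Sec I F A) : ∃ ν : Sec I F A, J.bracket (linFun μ) (linFun η) = linFun ν :=
    hJ.1 _ _ ⟨μ, rfl⟩ ⟨η, rfl⟩
  have hc (μ : Sec I F A) : ∃ f : C^∞⟮I, M; 𝓘(ℝ, ℝ), ℝ⟯,
      J.vec.deriv (linFun μ) = -basicFun F A f := by
    obtain ⟨f, hf⟩ := hJ.2 _ ⟨μ, rfl⟩
    exact ⟨f, neg_eq_iff_eq_neg.1 ((J.bracket_one _).symm.trans hf)⟩
  choose b hb using hb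
  choose c hc using hc
  have hE (f : C^∞⟮I, M; 𝓘(ℝ, ℝ), ℝ⟯) : J.vec.deriv (basicFun F A f) = 0 := by
    refine eq_zero_of_linFun_mul (I := I) (J.vec.contMDiff_deriv (hbas f)).continuous fun μ => ?_
    have h := J.vec.deriv_mul (hbas f) (hlin μ)
    rw [← linFun_funSMul, hc, hc] at h
    refine ⟨f * c μ - c (Sec.funSMul f μ), ?_⟩
    rw [← sub_eq_iff_eq_add'] at h
    rw [← h]
    funext p
    change -c (Sec.funSMul f μ) p.proj - f p.proj * -c μ p.proj =
      f p.proj * c μ p.proj - c (Sec.funSMul f μ) p.proj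
    ring
  have hd (μ : Sec I F A) (f : C^∞⟮I, M; 𝓘(ℝ, ℝ), ℝ⟯) : ∃ g : C^∞⟮I, M; 𝓘(ℝ, ℝ), ℝ⟯,
      J.Lam.onDiff (linFun μ) (basicFun F A f) = basicFun F A g := by
    have hsm := J.Lam.contMDiff_onDiff (hlin μ) (hbas f)
    have hz := eq_comp_zero_of_linFun_mul (I := I) hsm.continuous fun η => by
      refine ⟨b μ (Sec.funSMul f η) - Sec.funSMul f (b μ η), ?_⟩
      rw [linFun_sub, linFun_funSMul, ← hb, ← hb, JacobiStructure.bracket, linFun_funSMul,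
        J.Lam.onDiff_mul_right (hbas f) (hlin η), J.vec.deriv_mul (hbas f) (hlin η), hE,
        JacobiStructure.bracket]
      ring
    exact ⟨⟨_, hsm.comp (contMDiff_zeroSection ℝ (fun x => A x →L[ℝ] ℝ))⟩, funext hz⟩
  choose d hd using hd
  refine ⟨⟨b, c, d, hb, hc, hd, hE, fun f g => ?_⟩⟩
  refine eq_zero_of_linFun_mul (I := I) (J.Lam.contMDiff_onDiff (hbas f) (hbas g)).continuous
    fun μ => ⟨d (Sec.funSMul f μ) g - f * d μ g, ?_⟩
  have h := J.Lam.onDiff_mul_left (hbas f) (hlin μ) (basicFun F A g)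
  rw [← linFun_funSMul, hd, hd, ← sub_eq_iff_eq_add'] at h
  rw [← h]
  rfl

end Backward

/-! ### The Lie algebroid of a linear Jacobi structure -/

section Algebroid

variable {E : Type*} [NormedAddCommGroup E] [NormedSpace ℝ E]
  {H : Type*} [TopologicalSpace H] {I : ModelWithCorners ℝ E H}
  {M : Type*} [TopologicalSpace M] [ChartedSpace H M]
  {F : Type*} [NormedAddCommGroup F] [NormedSpace ℝ F]
  {A : M → Type*} [TopologicalSpace (TotalSpace F A)]
  [∀ x, AddCommGroup (A x)] [∀ x, Module ℝ (A x)] [∀ x, TopologicalSpace (A x)]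
  [FiberBundle F A] [VectorBundle ℝ F A]

theorem mvfderiv_mfderiv_proj {f : M → ℝ} (hf : ContMDiff I 𝓘(ℝ, ℝ) ∞ f)
    (p : DualTotal F A) (u : TangentSpace (I.prod 𝓘(ℝ, F →L[ℝ] ℝ)) p) :
    mvfderiv I f p.proj (show TangentSpace I p.proj from
      mfderiv (I.prod 𝓘(ℝ, F →L[ℝ] ℝ)) I TotalSpace.proj p u) =
      mvfderiv (I.prod 𝓘(ℝ, F →L[ℝ] ℝ)) (basicFun F A f) p u :=
  mvfderiv_mfderiv_of_eq rfl ((hf _).mdifferentiableAt (by simp))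
    ((contMDiffAt_proj _ (n := ∞)).mdifferentiableAt (by simp)) u

theorem tangent_ext_mvfderiv [FiniteDimensional ℝ E] [T2Space M] [IsManifold I ∞ M] {x : M}
    {u v : TangentSpace I x}
    (h : ∀ f : C^∞⟮I, M; 𝓘(ℝ, ℝ), ℝ⟯, mvfderiv I f x u = mvfderiv I f x v) : u = v := by
  refine tangent_ext fun α => ?_
  obtain ⟨f, rfl⟩ := exists_contMDiffMap_mvfderiv_eq x α
  exact h f

omit [TopologicalSpace M] [TopologicalSpace (TotalSpace F A)] [FiberBundle F A]
  [VectorBundle ℝ F A] in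
theorem basicFun_injective {f g : M → ℝ} (h : basicFun F A f = basicFun F A g) : f = g :=
  funext fun x => congrFun h ⟨x, 0⟩

theorem JacobiStructure.bracket_swap {N : Type*} [TopologicalSpace N] [ChartedSpace H N]
    [IsManifold I ∞ N] (J : JacobiStructure I N) (f g : N → ℝ) :
    J.bracket f g = -J.bracket g f := by
  rw [JacobiStructure.bracket, J.Lam.onDiff_swap, JacobiStructure.bracket]
  ring

theorem JacobiStructure.ext {N : Type*} [TopologicalSpace N] [ChartedSpace H N]
    [IsManifold I ∞ N] {J J' : JacobiStructure I N} (h : J.Lam = J'.Lam) (h' : J.vec = J'.vec) :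
    J = J' := by
  cases J
  cases J'
  subst h h'
  rfl

theorem PoissonStructure.ext {N : Type*} [TopologicalSpace N] [ChartedSpace H N]
    [IsManifold I ∞ N] {P Q : PoissonStructure I N} (h : P.Lam = Q.Lam) : P = Q := by
  cases P
  cases Q
  subst h
  rfl

/-- A Jacobi structure with vanishing vector field is a Poisson structure. -/
def JacobiStructure.toPoisson {N : Type*} [TopologicalSpace N] [ChartedSpace H N]
    [IsManifold I ∞ N] (J : JacobiStructure I N) (h : J.vec = 0) : PoissonStructure I N where
  Lam := J.Lam
  schouten_self f g k hf hg hk := by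
    rw [J.schouten_self f g k hf hg hk, h]
    have h0 (f : N → ℝ) : SmoothVectorField.deriv (0 : SmoothVectorField I N) f = 0 :=
      funext fun p => map_zero _
    simp [wedgeVectorBivector, h0]

/-- A Poisson structure is a Jacobi structure with vanishing vector field. -/
def PoissonStructure.toJacobi {N : Type*} [TopologicalSpace N] [ChartedSpace H N]
    [IsManifold I ∞ N] (P : PoissonStructure I N) : JacobiStructure I N where
  Lam := P.Lam
  vec := 0
  schouten_self f g k hf hg hk := by
    rw [P.schouten_self f g k hf hg hk]
    have h0 (f : N → ℝ) : SmoothVectorField.deriv (0 : SmoothVectorField I N) f = 0 :=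
      funext fun p => map_zero _
    simp [wedgeVectorBivector, h0]
  schouten_vec f g _ _ := by
    have h0 (f : N → ℝ) : SmoothVectorField.deriv (0 : SmoothVectorField I N) f = 0 :=
      funext fun p => map_zero _
    have h1 (f : N → ℝ) : P.Lam.onDiff f 0 = 0 := funext fun p => by
      have h : mvfderiv I (0 : N → ℝ) p = 0 := mvfderiv_const 0
      simp [BivectorField.onDiff, h]
    rw [schoutenVector, h0, h0, h0, h1, P.Lam.onDiff_swap, h1]
    simp

theorem JacobiStructure.bracket_of_vec_eq_zero {N : Type*} [TopologicalSpace N] [ChartedSpace H N]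
    [IsManifold I ∞ N] {J : JacobiStructure I N} (h : J.vec = 0) (f g : N → ℝ) :
    J.bracket f g = J.Lam.onDiff f g := by
  have h0 (f : N → ℝ) : SmoothVectorField.deriv (0 : SmoothVectorField I N) f = 0 :=
    funext fun p => map_zero _
  simp [JacobiStructure.bracket, h, h0]

variable [IsManifold I ∞ M] [ContMDiffVectorBundle ∞ F A I]

namespace LinearJacobiData

variable {J : JacobiStructure (I.prod 𝓘(ℝ, F →L[ℝ] ℝ)) (DualTotal F A)} (D : LinearJacobiData J)

theorem form_add (μ η : Sec I F A) : D.form (μ + η) = D.form μ + D.form η := by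
  have h := D.deriv_linFun (μ + η)
  rw [linFun_add, J.vec.deriv_add (contMDiff_linFun μ) (contMDiff_linFun η), D.deriv_linFun,
    D.deriv_linFun] at h
  ext x
  have := congrFun h ⟨x, 0⟩
  change -D.form μ x + -D.form η x = -D.form (μ + η) x at this
  change D.form (μ + η) x = D.form μ x + D.form η x
  linarith

theorem form_funSMul (f : C^∞⟮I, M; 𝓘(ℝ, ℝ), ℝ⟯) (μ : Sec I F A) :
    D.form (Sec.funSMul f μ) = f * D.form μ := by
  have h := D.deriv_linFun (Sec.funSMul f μ)
  rw [linFun_funSMul, J.vec.deriv_mul (contMDiff_basicFun f.contMDiff) (contMDiff_linFun μ),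
    D.deriv_linFun, D.deriv_basicFun] at h
  ext x
  have := congrFun h ⟨x, 0⟩
  change f x * -D.form μ x + _ * 0 = -D.form (Sec.funSMul f μ) x at this
  change D.form (Sec.funSMul f μ) x = f x * D.form μ x
  linarith

theorem add_act (μ η : Sec I F A) (f : C^∞⟮I, M; 𝓘(ℝ, ℝ), ℝ⟯) :
    D.act (μ + η) f = D.act μ f + D.act η f := by
  have h := D.onDiff_linFun_basicFun (μ + η) f
  rw [linFun_add, J.Lam.onDiff_add_left (contMDiff_linFun μ) (contMDiff_linFun η),
    D.onDiff_linFun_basicFun, D.onDiff_linFun_basicFun] at h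
  ext x
  exact (congrFun h ⟨x, 0⟩).symm

theorem funSMul_act (f : C^∞⟮I, M; 𝓘(ℝ, ℝ), ℝ⟯) (μ : Sec I F A) (g : C^∞⟮I, M; 𝓘(ℝ, ℝ), ℝ⟯) :
    D.act (Sec.funSMul f μ) g = f * D.act μ g := by
  have h := D.onDiff_linFun_basicFun (Sec.funSMul f μ) g
  rw [linFun_funSMul, J.Lam.onDiff_mul_left (contMDiff_basicFun f.contMDiff) (contMDiff_linFun μ),
    D.onDiff_linFun_basicFun, D.onDiff_basicFun, mul_zero, add_zero] at h
  ext x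
  exact (congrFun h ⟨x, 0⟩).symm

theorem act_add (μ : Sec I F A) (f g : C^∞⟮I, M; 𝓘(ℝ, ℝ), ℝ⟯) :
    D.act μ (f + g) = D.act μ f + D.act μ g := by
  refine DFunLike.coe_injective (basicFun_injective (F := F) (A := A) ?_)
  rw [← D.onDiff_linFun_basicFun]
  change J.Lam.onDiff _ (basicFun F A f + basicFun F A g) =
    basicFun F A (D.act μ f) + basicFun F A (D.act μ g)
  rw [J.Lam.onDiff_add_right (contMDiff_basicFun f.contMDiff) (contMDiff_basicFun g.contMDiff),
    D.onDiff_linFun_basicFun, D.onDiff_linFun_basicFun]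

theorem act_mul (μ : Sec I F A) (f g : C^∞⟮I, M; 𝓘(ℝ, ℝ), ℝ⟯) :
    D.act μ (f * g) = f * D.act μ g + g * D.act μ f := by
  refine DFunLike.coe_injective (basicFun_injective (F := F) (A := A) ?_)
  rw [← D.onDiff_linFun_basicFun]
  change J.Lam.onDiff _ (basicFun F A f * basicFun F A g) =
    basicFun F A f * basicFun F A (D.act μ g) + basicFun F A g * basicFun F A (D.act μ f)
  rw [J.Lam.onDiff_mul_right (contMDiff_basicFun f.contMDiff) (contMDiff_basicFun g.contMDiff),
    D.onDiff_linFun_basicFun, D.onDiff_linFun_basicFun]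

theorem act_const (μ : Sec I F A) (c : ℝ) :
    D.act μ (ContMDiffMap.const c) = 0 := by
  refine DFunLike.coe_injective (basicFun_injective (F := F) (A := A) ?_)
  rw [← D.onDiff_linFun_basicFun]
  funext p
  have h : mvfderiv (I.prod 𝓘(ℝ, F →L[ℝ] ℝ)) (fun _ : DualTotal F A => c) p = 0 :=
    mvfderiv_const c
  change J.Lam.toSection p _ (mvfderiv _ (fun _ : DualTotal F A => c) p) = 0
  rw [h, map_zero]

theorem bracket_swap (μ η : Sec I F A) : D.bracket μ η = -D.bracket η μ := by
  refine linFun_injective ?_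
  rw [← D.linFun_bracket, J.bracket_swap, D.linFun_bracket, ← neg_one_smul ℝ (D.bracket η μ),
    linFun_smul, neg_one_smul]

theorem bracket_self (μ : Sec I F A) : D.bracket μ μ = 0 := by
  have h : (2 : ℝ) • D.bracket μ μ = 0 := by
    rw [two_smul]
    nth_rewrite 1 [D.bracket_swap]
    exact neg_add_cancel _
  rw [← one_smul ℝ (D.bracket μ μ), ← inv_mul_cancel₀ (two_ne_zero (α := ℝ)), mul_smul, h,
    smul_zero]

theorem bracket_add (μ η ζ : Sec I F A) :
    D.bracket μ (η + ζ) = D.bracket μ η + D.bracket μ ζ := by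
  refine linFun_injective ?_
  simp only [linFun_add, ← D.linFun_bracket, JacobiStructure.bracket,
    J.Lam.onDiff_add_right (contMDiff_linFun η) (contMDiff_linFun ζ),
    J.vec.deriv_add (contMDiff_linFun η) (contMDiff_linFun ζ)]
  ring

theorem bracket_funSMul (f : C^∞⟮I, M; 𝓘(ℝ, ℝ), ℝ⟯) (μ η : Sec I F A) :
    D.bracket μ (Sec.funSMul f η) = Sec.funSMul f (D.bracket μ η) + Sec.funSMul (D.act μ f) η := by
  refine linFun_injective ?_
  simp only [linFun_add, linFun_funSMul, ← D.linFun_bracket, JacobiStructure.bracket,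
    J.Lam.onDiff_mul_right (contMDiff_basicFun f.contMDiff) (contMDiff_linFun η),
    J.vec.deriv_mul (contMDiff_basicFun f.contMDiff) (contMDiff_linFun η), D.deriv_basicFun,
    D.onDiff_linFun_basicFun]
  ring

theorem bracket_smul (c : ℝ) (μ η : Sec I F A) : D.bracket μ (c • η) = c • D.bracket μ η := by
  have h (ζ : Sec I F A) : c • ζ = Sec.funSMul (ContMDiffMap.const c) ζ := rfl
  rw [h η, D.bracket_funSMul, D.act_const, h]
  ext x
  change _ + (0 : ℝ) • η x = _
  rw [zero_smul, add_zero]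

theorem jacobi (μ η ζ : Sec I F A) :
    D.bracket μ (D.bracket η ζ) + D.bracket η (D.bracket ζ μ) + D.bracket ζ (D.bracket μ η) = 0 := by
  refine linFun_injective ?_
  have h := J.bracket_jacobi (contMDiff_linFun μ) (contMDiff_linFun η) (contMDiff_linFun ζ)
  simp only [D.linFun_bracket, ← linFun_add] at h
  rw [linFun_zero, ← neg_zero, ← h, ← neg_one_smul ℝ, ← linFun_smul, D.bracket_swap μ,
    D.bracket_swap η (D.bracket ζ μ), D.bracket_swap ζ (D.bracket μ η)]
  congr 1
  module

theorem bracket_linFun_basicFun (μ : Sec I F A) (f : C^∞⟮I, M; 𝓘(ℝ, ℝ), ℝ⟯) :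
    J.bracket (linFun μ) (basicFun F A f) =
      basicFun F A (D.act μ f + f * D.form μ : C^∞⟮I, M; 𝓘(ℝ, ℝ), ℝ⟯) := by
  rw [JacobiStructure.bracket, D.onDiff_linFun_basicFun, D.deriv_basicFun, D.deriv_linFun,
    mul_zero, add_zero, mul_neg, sub_neg_eq_add]
  rfl

theorem bracket_act_add (μ η : Sec I F A) (f : C^∞⟮I, M; 𝓘(ℝ, ℝ), ℝ⟯) :
    D.act (D.bracket μ η) f + f * D.form (D.bracket μ η) =
      D.act μ (D.act η f) - D.act η (D.act μ f)
        + f * (D.act μ (D.form η) - D.act η (D.form μ)) := by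
  have h := J.bracket_jacobi (contMDiff_linFun μ) (contMDiff_linFun η)
    (contMDiff_basicFun f.contMDiff)
  rw [J.bracket_swap _ (linFun μ), J.bracket_swap (basicFun F A f) (linFun μ),
    J.bracket_swap (-_) (linFun η)] at h
  have hneg (μ : Sec I F A) (g : DualTotal F A → ℝ) :
      J.bracket (linFun μ) (-g) = -J.bracket (linFun μ) g := by
    rw [JacobiStructure.bracket, J.Lam.onDiff_swap, J.Lam.onDiff_neg_left, J.vec.deriv_neg,
      J.Lam.onDiff_swap g, JacobiStructure.bracket]
    ring
  rw [hneg, neg_neg, D.linFun_bracket] at h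
  simp only [D.bracket_linFun_basicFun] at h
  have h' : D.act (D.bracket μ η) f + f * D.form (D.bracket μ η)
      + -(D.act μ (D.act η f + f * D.form η) + (D.act η f + f * D.form η) * D.form μ)
      + (D.act η (D.act μ f + f * D.form μ) + (D.act μ f + f * D.form μ) * D.form η) = 0 :=
    DFunLike.coe_injective (basicFun_injective (F := F) (A := A) h)
  simp only [D.act_add, D.act_mul] at h'
  linear_combination h'

theorem form_bracket (μ η : Sec I F A) :
    D.form (D.bracket μ η) = D.act μ (D.form η) - D.act η (D.form μ) := by
  have h := D.bracket_act_add μ η 1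
  have h1 (μ : Sec I F A) : D.act μ 1 = 0 := D.act_const μ 1
  have h0 (μ : Sec I F A) : D.act μ 0 = 0 := D.act_const μ 0
  simpa [h1, h0] using h

theorem bracket_act (μ η : Sec I F A) (f : C^∞⟮I, M; 𝓘(ℝ, ℝ), ℝ⟯) :
    D.act (D.bracket μ η) f = D.act μ (D.act η f) - D.act η (D.act μ f) := by
  have h := D.bracket_act_add μ η f
  rw [D.form_bracket] at h
  exact add_right_cancel h

variable [FiniteDimensional ℝ E] [FiniteDimensional ℝ F] [T2Space M]
  [∀ x, IsTopologicalAddGroup (A x)] [∀ x, ContinuousSMul ℝ (A x)]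

/-- The value of the form at `x`. -/
def formAt (x : M) : A x →L[ℝ] ℝ :=
  ∑ i, D.form (frameSection I F A x i) x • dualFrame F A x i

omit [∀ x, IsTopologicalAddGroup (A x)] [∀ x, ContinuousSMul ℝ (A x)] in
theorem formAt_apply (x : M) (μ : Sec I F A) : D.formAt x (μ x) = D.form μ x := by
  let T : Sec I F A →+ ℝ := AddMonoidHom.mk' (fun μ => D.form μ x) fun μ η => by
    rw [D.form_add]; rfl
  have h := Sec.tensor_eq_sum T (x := x) (fun f μ => by
    change D.form _ x = f x • D.form μ x
    rw [D.form_funSMul]; rfl) μ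
  refine Eq.trans ?_ h.symm
  simp only [formAt, sum_apply, smul_apply, smul_eq_mul]
  exact Finset.sum_congr rfl fun i _ => mul_comm _ _

/-- The section of the dual bundle determined by the vector field of a linear Jacobi structure. -/
def dualSec : DualSec I F A where
  toFun := D.formAt
  contMDiff_toFun x₀ := by
    refine contMDiffAt_homSection_of_apply fun v => contMDiff_real_section_iff.2 ?_
    obtain ⟨σ, hσ⟩ := exists_sec_trivialization I A x₀ v
    refine ((D.form σ).contMDiff x₀).congr_of_eventuallyEq ?_
    filter_upwards [hσ] with y hy
    rw [← hy, formAt_apply]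

theorem dualSec_app (μ : Sec I F A) : DualSec.app D.dualSec μ = D.form μ := by
  ext x
  exact D.formAt_apply x μ

/-- The value at `x` of the image of a section under the anchor. -/
def anchorVec (μ : Sec I F A) (x : M) : TangentSpace I x :=
  mfderiv (I.prod 𝓘(ℝ, F →L[ℝ] ℝ)) I TotalSpace.proj (⟨x, 0⟩ : DualTotal F A)
    (vectorOfBidual (J.Lam.toSection ⟨x, 0⟩
      (mvfderiv (I.prod 𝓘(ℝ, F →L[ℝ] ℝ)) (linFun μ) ⟨x, 0⟩)))

omit [T2Space M] [∀ x, IsTopologicalAddGroup (A x)] [∀ x, ContinuousSMul ℝ (A x)] in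
theorem mvfderiv_anchorVec (μ : Sec I F A) (f : C^∞⟮I, M; 𝓘(ℝ, ℝ), ℝ⟯) (x : M) :
    mvfderiv I f x (anchorVec (J := J) μ x) = D.act μ f x := by
  refine (mvfderiv_mfderiv_proj f.contMDiff (⟨x, 0⟩ : DualTotal F A) _).trans ?_
  rw [apply_vectorOfBidual]
  exact congrFun (D.onDiff_linFun_basicFun μ f) ⟨x, 0⟩

variable (J) in
/-- The anchor of a linear Jacobi structure. -/
def anchor (x : M) : A x →L[ℝ] TangentSpace I x :=
  ∑ i, (dualFrame F A x i).smulRight (anchorVec (J := J) (frameSection I F A x i) x)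

omit [∀ x, IsTopologicalAddGroup (A x)] [∀ x, ContinuousSMul ℝ (A x)] in
theorem anchor_apply (D : LinearJacobiData J) (x : M) (μ : Sec I F A) :
    anchor J x (μ x) = anchorVec (J := J) μ x := by
  let T : Sec I F A →+ TangentSpace I x := AddMonoidHom.mk' (fun μ => anchorVec (J := J) μ x)
    fun μ η => tangent_ext_mvfderiv fun f => by
      rw [map_add, D.mvfderiv_anchorVec, D.mvfderiv_anchorVec, D.mvfderiv_anchorVec, D.add_act]
      rfl
  have h := Sec.tensor_eq_sum T (x := x) (fun f μ => tangent_ext_mvfderiv fun g => by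
    change mvfderiv I g x (anchorVec (J := J) (Sec.funSMul f μ) x) =
      mvfderiv I g x (f x • anchorVec (J := J) μ x)
    rw [map_smul, D.mvfderiv_anchorVec, D.mvfderiv_anchorVec, D.funSMul_act]
    rfl) μ
  refine Eq.trans ?_ h.symm
  simp only [anchor, sum_apply]
  rfl

omit [∀ x, IsTopologicalAddGroup (A x)] [∀ x, ContinuousSMul ℝ (A x)] in
theorem mvfderiv_anchor (μ : Sec I F A) (f : C^∞⟮I, M; 𝓘(ℝ, ℝ), ℝ⟯) (x : M) :
    mvfderiv I f x (anchor J x (μ x)) = D.act μ f x := by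
  rw [D.anchor_apply, D.mvfderiv_anchorVec]

omit [∀ x, IsTopologicalAddGroup (A x)] [∀ x, ContinuousSMul ℝ (A x)] in
theorem contMDiff_anchor_apply (D : LinearJacobiData J) (μ : Sec I F A) :
    ContMDiff I I.tangent ∞ (fun x => (⟨x, anchor J x (μ x)⟩ : TangentBundle I M)) := by
  intro x₀
  refine contMDiffAt_tangentSection_of_apply fun α => ?_
  obtain ⟨f, hf⟩ := exists_contMDiffMap_eq_extChartAt (I := I) x₀ α
  refine ((D.act μ f).contMDiff x₀).congr_of_eventuallyEq ?_
  filter_upwards [eventually_eventually_nhds.2 hf,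
    (chartAt H x₀).open_source.mem_nhds (mem_chart_source H x₀)] with y hy hys
  have h := D.mvfderiv_anchor μ f y
  rw [mvfderiv_congr_of_eventuallyEq hy, mvfderiv_comp_extChartAt x₀ α hys] at h
  exact h

theorem contMDiff_anchor (D : LinearJacobiData J) :
    ContMDiff (I.prod 𝓘(ℝ, F)) I.tangent ∞
      (fun v : TotalSpace F A => (⟨v.proj, anchor J v.proj v.2⟩ : TangentBundle I M)) := by
  intro v₀
  have h0 : ContMDiffAt I (I.prod 𝓘(ℝ, F →L[ℝ] E)) ∞
      (fun x => TotalSpace.mk' (F →L[ℝ] E) (E := fun x => A x →L[ℝ] TangentSpace I x) x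
        (anchor J x)) v₀.proj := by
    refine contMDiffAt_homSection_of_apply fun v => ?_
    obtain ⟨σ, hσ⟩ := exists_sec_trivialization I A v₀.proj v
    refine (D.contMDiff_anchor_apply σ v₀.proj).congr_of_eventuallyEq ?_
    filter_upwards [hσ] with y hy
    rw [hy]
  have h1 : ContMDiffAt (I.prod 𝓘(ℝ, F)) (I.prod 𝓘(ℝ, F →L[ℝ] E)) ∞
      (fun m : TotalSpace F A => TotalSpace.mk' (F →L[ℝ] E)
        (E := fun x => A x →L[ℝ] TangentSpace I x) m.proj (anchor J m.proj)) v₀ :=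
    h0.comp v₀ (contMDiffAt_proj _)
  have h2 : ContMDiffAt (I.prod 𝓘(ℝ, F)) (I.prod 𝓘(ℝ, F)) ∞
      (fun m : TotalSpace F A => TotalSpace.mk' F m.proj m.2) v₀ := contMDiffAt_id
  exact ContMDiffAt.clm_bundle_apply (F₂ := E) (E₂ := fun x : M => TangentSpace I x)
    (ϕ := fun m : TotalSpace F A => anchor J m.proj) h1 h2

/-- The Lie algebroid of a linear Jacobi structure. -/
def lieAlgebroid : LieAlgebroid I F A where
  bracket := LinearMap.mk₂ ℝ D.bracket
    (fun μ η ζ => by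
      rw [D.bracket_swap, D.bracket_add, D.bracket_swap μ, D.bracket_swap η, neg_add])
    (fun c μ η => by rw [D.bracket_swap, D.bracket_smul, D.bracket_swap μ, smul_neg])
    D.bracket_add fun c μ η => D.bracket_smul c μ η
  bracket_self := D.bracket_self
  jacobi := D.jacobi
  anchor := anchor J
  anchor_smooth := D.contMDiff_anchor
  anchor_bracket μ η x := by
    have : CompleteSpace E := FiniteDimensional.complete ℝ E
    refine tangent_ext_mvfderiv fun f => ?_
    rw [mvfderiv_mlieBracket (D.contMDiff_anchor_apply μ) (D.contMDiff_anchor_apply η)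
      f.contMDiff]
    simp only [LinearMap.mk₂_apply, D.mvfderiv_anchor]
    exact congrArg (fun g : C^∞⟮I, M; 𝓘(ℝ, ℝ), ℝ⟯ => g x) (D.bracket_act μ η f)
  leibniz f μ η x := by
    rw [D.mvfderiv_anchor]
    exact congrArg (fun ν : Sec I F A => ν x) (D.bracket_funSMul f μ η)

theorem lieAlgebroid_act (μ : Sec I F A) (f : C^∞⟮I, M; 𝓘(ℝ, ℝ), ℝ⟯) :
    D.lieAlgebroid.act μ f = D.act μ f := by
  ext x
  exact D.mvfderiv_anchor μ f x

/-- The Lie algebroid with cocycle of a linear Jacobi structure. -/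
def algebroidWithCocycle : AlgebroidWithCocycle I F A where
  alg := D.lieAlgebroid
  form := D.dualSec
  cocycle μ η x := by
    have h := D.form_bracket μ η
    simp only [← dualSec_app, ← lieAlgebroid_act] at h
    exact congrArg (fun g : C^∞⟮I, M; 𝓘(ℝ, ℝ), ℝ⟯ => g x) h

theorem jacobiStructure_algebroidWithCocycle : D.algebroidWithCocycle.jacobiStructure = J := by
  refine JacobiStructure.ext ?_ ?_
  · change D.algebroidWithCocycle.bivectorField = _
    refine BivectorField.ext_affFun fun μ η f g => ?_
    have h : J.Lam.onDiff (linFun μ) (linFun η) =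
        linFun (D.algebroidWithCocycle.twistedBracket μ η) := by
      have h1 := D.linFun_bracket μ η
      rw [JacobiStructure.bracket, D.deriv_linFun, D.deriv_linFun] at h1
      rw [AlgebroidWithCocycle.twistedBracket, linFun_add, linFun_sub, linFun_funSMul,
        linFun_funSMul]
      change _ = linFun (D.bracket μ η) + (basicFun F A (DualSec.app D.dualSec η) * _ -
        basicFun F A (DualSec.app D.dualSec μ) * _)
      rw [← h1, dualSec_app, dualSec_app]
      ring
    rw [AlgebroidWithCocycle.bivectorField_onDiff]
    change _ = J.Lam.onDiff (linFun μ + basicFun F A f) (linFun η + basicFun F A g)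
    have hf := contMDiff_basicFun (F := F) (A := A) f.contMDiff
    have hg := contMDiff_basicFun (F := F) (A := A) g.contMDiff
    rw [J.Lam.onDiff_add_left (contMDiff_linFun μ) hf,
      J.Lam.onDiff_add_right (contMDiff_linFun η) hg,
      J.Lam.onDiff_add_right (contMDiff_linFun η) hg, D.onDiff_basicFun, h,
      D.onDiff_linFun_basicFun, J.Lam.onDiff_swap (basicFun F A f), D.onDiff_linFun_basicFun,
      ← lieAlgebroid_act, ← lieAlgebroid_act, add_zero, affFun, add_assoc, ← sub_eq_add_neg]
    rfl
  · refine ContMDiffSection.ext fun p => vectorField_ext_affFun fun μ f => ?_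
    refine (D.algebroidWithCocycle.mvfderiv_affFun_vec μ f p).trans ?_
    have h := J.vec.deriv_add (contMDiff_linFun μ)
      (contMDiff_basicFun (F := F) (A := A) f.contMDiff)
    rw [D.deriv_linFun, D.deriv_basicFun, add_zero, ← dualSec_app] at h
    refine Eq.trans ?_ (congrFun h p).symm
    rw [affFun, linFun_zero, zero_add]
    rfl

end LinearJacobiData

variable [FiniteDimensional ℝ E] [FiniteDimensional ℝ F] [T2Space M]
  [∀ x, IsTopologicalAddGroup (A x)] [∀ x, ContinuousSMul ℝ (A x)]

theorem exists_jacobiStructure_eq [Nontrivial F]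
    {J : JacobiStructure (I.prod 𝓘(ℝ, F →L[ℝ] ℝ)) (DualTotal F A)}
    (hJ : J ∈ linearJacobi I F A) : ∃ a : AlgebroidWithCocycle I F A, a.jacobiStructure = J :=
  let ⟨D⟩ := nonempty_linearJacobiData hJ
  ⟨_, D.jacobiStructure_algebroidWithCocycle⟩

/-! ### Linear Poisson structures -/

theorem AlgebroidWithCocycle.jacobiStructure_vec_eq_zero_iff (a : AlgebroidWithCocycle I F A) :
    a.jacobiStructure.vec = 0 ↔ a.form = 0 := by
  constructor
  · intro h
    ext x v
    obtain ⟨μ, rfl⟩ := exists_sec_apply_eq I F x v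
    have h1 := a.vectorField_deriv_linFun μ
    change a.vectorField = 0 at h
    rw [h] at h1
    have h2 := congrFun h1 ⟨x, 0⟩
    have h3 : SmoothVectorField.deriv (0 : SmoothVectorField (I.prod 𝓘(ℝ, F →L[ℝ] ℝ))
      (DualTotal F A)) (linFun μ) ⟨x, 0⟩ = 0 := map_zero _
    rw [h3] at h2
    exact (neg_eq_zero.1 h2.symm : a.form x (μ x) = 0)
  · intro h
    refine ContMDiffSection.ext fun p => vectorField_ext_affFun fun μ f => ?_
    refine (a.mvfderiv_affFun_vec μ f p).trans ?_
    rw [affFun, linFun_zero, zero_add, h]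
    refine Eq.trans ?_ (map_zero _).symm
    exact neg_zero

/-- A Lie algebroid with the zero cocycle. -/
def LieAlgebroid.withZeroCocycle (L : LieAlgebroid I F A) : AlgebroidWithCocycle I F A where
  alg := L
  form := 0
  cocycle μ η x := by
    change (0 : ℝ) = mvfderiv I (fun _ : M => (0 : ℝ)) x _ - mvfderiv I (fun _ : M => (0 : ℝ)) x _
    rw [mvfderiv_const]
    simp

theorem LieAlgebroid.withZeroCocycle_bivec (L : LieAlgebroid I F A) (p : DualTotal F A) :
    L.withZeroCocycle.bivec p = L.dualPoisson p := by
  refine ContinuousLinearMap.ext fun α => ContinuousLinearMap.ext fun β => ?_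
  obtain ⟨μ, f, rfl⟩ := exists_affFun_mvfderiv (I := I) p α
  obtain ⟨η, g, rfl⟩ := exists_affFun_mvfderiv (I := I) p β
  have h (μ : Sec I F A) (f : C^∞⟮I, M; 𝓘(ℝ, ℝ), ℝ⟯) :
      mvfderiv (I.prod 𝓘(ℝ, F →L[ℝ] ℝ)) (affFun μ f) p
        (verticalLift L.withZeroCocycle.form p) = 0 := by
    rw [mvfderiv_affFun _ f.contMDiff, verticalLift, add_apply, mvfderiv_linFun_verticalVec,
      mvfderiv_basicFun_verticalVec f.contMDiff, add_zero]
    rfl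
  rw [AlgebroidWithCocycle.bivec, add_apply, add_apply, wedgeVec_apply, h, h, mul_zero, zero_mul,
    sub_zero, add_zero]
  rfl

omit [FiniteDimensional ℝ E] [FiniteDimensional ℝ F] [T2Space M]
  [∀ x, IsTopologicalAddGroup (A x)] [∀ x, ContinuousSMul ℝ (A x)] in
theorem PoissonStructure.toJacobi_mem_linearJacobi
    {P : PoissonStructure (I.prod 𝓘(ℝ, F →L[ℝ] ℝ)) (DualTotal F A)}
    (hP : P ∈ linearPoisson I F A) : P.toJacobi ∈ linearJacobi I F A := by
  constructor
  · intro f g hf hg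
    rw [JacobiStructure.bracket_of_vec_eq_zero rfl]
    exact hP f g hf hg
  · intro f _
    refine ⟨0, ?_⟩
    rw [JacobiStructure.bracket_one]
    funext p
    exact neg_eq_zero.2 (map_zero _)

theorem LieAlgebroid.withZeroCocycle_vec (L : LieAlgebroid I F A) :
    L.withZeroCocycle.jacobiStructure.vec = 0 :=
  L.withZeroCocycle.jacobiStructure_vec_eq_zero_iff.2 rfl

/-- The linear Poisson structure of a Lie algebroid. -/
def LieAlgebroid.poissonStructure (L : LieAlgebroid I F A) :
    PoissonStructure (I.prod 𝓘(ℝ, F →L[ℝ] ℝ)) (DualTotal F A) :=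
  L.withZeroCocycle.jacobiStructure.toPoisson L.withZeroCocycle_vec

theorem LieAlgebroid.poissonStructure_mem_linearPoisson (L : LieAlgebroid I F A) :
    L.poissonStructure ∈ linearPoisson I F A := by
  intro f g hf hg
  have h := L.withZeroCocycle.jacobiStructure_mem_linearJacobi.1 f g hf hg
  rwa [JacobiStructure.bracket_of_vec_eq_zero L.withZeroCocycle_vec] at h

omit [ContMDiffVectorBundle ∞ F A I] [FiniteDimensional ℝ E] [FiniteDimensional ℝ F]
  [T2Space M] in
theorem LieAlgebroid.withZeroCocycle_alg {a : AlgebroidWithCocycle I F A} (h : a.form = 0) :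
    a.alg.withZeroCocycle = a := by
  cases a
  subst h
  rfl

theorem LieAlgebroid.poissonStructure_injective :
    Function.Injective (poissonStructure (I := I) (F := F) (A := A)) := by
  intro L L' h
  have h1 : L.withZeroCocycle.jacobiStructure = L'.withZeroCocycle.jacobiStructure :=
    JacobiStructure.ext (congrArg PoissonStructure.Lam h)
      (L.withZeroCocycle_vec.trans L'.withZeroCocycle_vec.symm)
  have h2 : L.withZeroCocycle = L'.withZeroCocycle :=
    AlgebroidWithCocycle.jacobiStructure_injective h1
  exact congrArg AlgebroidWithCocycle.alg h2

theorem LieAlgebroid.exists_poissonStructure_eq [Nontrivial F]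
    {P : PoissonStructure (I.prod 𝓘(ℝ, F →L[ℝ] ℝ)) (DualTotal F A)}
    (hP : P ∈ linearPoisson I F A) : ∃ L : LieAlgebroid I F A, L.poissonStructure = P := by
  obtain ⟨a, ha⟩ := exists_jacobiStructure_eq (P.toJacobi_mem_linearJacobi hP)
  have h : a.form = 0 := a.jacobiStructure_vec_eq_zero_iff.1 (by rw [ha]; rfl)
  refine ⟨a.alg, PoissonStructure.ext ?_⟩
  change a.alg.withZeroCocycle.jacobiStructure.Lam = _
  rw [LieAlgebroid.withZeroCocycle_alg h, ha]
  rfl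

end Algebroid

end

theorem theorem3
    {E : Type*} [NormedAddCommGroup E] [NormedSpace ℝ E] [FiniteDimensional ℝ E]
    {H : Type*} [TopologicalSpace H] (I : ModelWithCorners ℝ E H) [I.Boundaryless]
    {M : Type*} [TopologicalSpace M] [T2Space M] [ChartedSpace H M] [IsManifold I ∞ M]
    (F : Type*) [NormedAddCommGroup F] [NormedSpace ℝ F] [FiniteDimensional ℝ F] [Nontrivial F]
    (A : M → Type*) [TopologicalSpace (TotalSpace F A)]
    [∀ x, AddCommGroup (A x)] [∀ x, Module ℝ (A x)] [∀ x, TopologicalSpace (A x)]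
    [∀ x, IsTopologicalAddGroup (A x)] [∀ x, ContinuousSMul ℝ (A x)]
    [FiberBundle F A] [VectorBundle ℝ F A] [ContMDiffVectorBundle ∞ F A I] :
    ∃ Ψ : AlgebroidWithCocycle I F A → linearJacobi I F A,
      -- `Ψ` is the map `((⟦,⟧, ρ), φ) ↦ (Λ_{(A*, φ)}, E_{(A*, φ)})`
      (∀ a p, (Ψ a).1.Lam.toSection p = a.bivec p) ∧
      (∀ a p, (Ψ a).1.vec p = a.vec p) ∧
      Function.Bijective Ψ ∧
      -- `Ψ` restricts to a bijection from the pairs with `φ = 0` to the structures with `E = 0`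
      Set.BijOn Ψ {a | a.form = 0} {J | J.1.vec = 0} ∧
      -- and this is the bijection from Lie algebroid structures to linear Poisson structures
      ∃ Ψ₀ : LieAlgebroid I F A → linearPoisson I F A,
        (∀ L p, (Ψ₀ L).1.Lam.toSection p = L.dualPoisson p) ∧
        Function.Bijective Ψ₀ ∧
        ∀ a, a.form = 0 → (Ψ a).1.Lam = (Ψ₀ a.alg).1.Lam := by
  refine ⟨fun a => ⟨a.jacobiStructure, a.jacobiStructure_mem_linearJacobi⟩, fun _ _ => rfl,
    fun _ _ => rfl, ⟨?_, ?_⟩, ⟨?_, ?_, ?_⟩,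
    fun L => ⟨L.poissonStructure, L.poissonStructure_mem_linearPoisson⟩,
    fun L p => L.withZeroCocycle_bivec p, ⟨?_, ?_⟩, ?_⟩
  · intro a b h
    exact AlgebroidWithCocycle.jacobiStructure_injective (congrArg Subtype.val h)
  · rintro ⟨J, hJ⟩
    obtain ⟨a, rfl⟩ := exists_jacobiStructure_eq hJ
    exact ⟨a, rfl⟩
  · intro a ha
    exact a.jacobiStructure_vec_eq_zero_iff.2 ha
  · intro a _ b _ h
    exact AlgebroidWithCocycle.jacobiStructure_injective (congrArg Subtype.val h)
  · rintro ⟨J, hJ⟩ h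
    obtain ⟨a, rfl⟩ := exists_jacobiStructure_eq hJ
    exact ⟨a, a.jacobiStructure_vec_eq_zero_iff.1 h, rfl⟩
  · intro L L' h
    exact LieAlgebroid.poissonStructure_injective (congrArg Subtype.val h)
  · rintro ⟨P, hP⟩
    obtain ⟨L, rfl⟩ := LieAlgebroid.exists_poissonStructure_eq hP
    exact ⟨L, rfl⟩
  · intro a ha
    change a.jacobiStructure.Lam = a.alg.withZeroCocycle.jacobiStructure.Lam
    rw [LieAlgebroid.withZeroCocycle_alg ha]
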